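/- Let $K\subset\mathbb R^n$ be a bounded convex set with non-empty interior that is symmetric ($K=-K$), and let $\|\cdot\|$ be a semi-norm on $\mathbb R^n$. Write $|K|$ for the Lebesgue measure of $K$, and $n_x$ for the outer unit normal to $K$ at a boundary point $x$ (it is unique for almost every $x\in\partial K$); integrals over $\partial K$ are taken with respect to the $(n-1)$-dimensional Hausdorff measure $H_{n-1}$, normalized to agree with Lebesgue measure on $(n-1)$-dimensional subspaces. Then the functions $x\mapsto \|n_x\|^2/\langle x,n_x\rangle$ and $x\mapsto\|n_x\|$ are integrable on $\partial K$ and $$\int_{\partial K} \frac{\|n_x\|^2}{\langle x,n_x\rangle}\,dH_{n-1}(x)\le \frac{1}{|K|}\left(\int_{\partial K} \|n_x\|\,dH_{n-1}(x) \right)^2.$$ Furthermore, if $\|\cdot\|$ is not identically zero, then equality holds if and only if there are a vector $v\in\mathbb R^n$, a number $c>0$ and an $(n-1)$-dimensional symmetric convex set $C\subset\mathbb R^n$ such that $\|x\|=|\langle x,v\rangle|$ for all $x\in\mathbb R^n$ and the closure of $K$ is $C+[-cv,cv]$ (in particular $K=C+[-cv,cv]$ if $K$ is compact). -/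

import Mathlib

open MeasureTheory
open scoped Pointwise

/-- `u` is an outer unit normal vector of the convex set `K` at the point `x`: it has length one and
`K` lies in the half-space `{y | ⟨y, u⟩ ≤ ⟨x, u⟩}`. -/
def IsOuterUnitNormal {n : ℕ} (K : Set (EuclideanSpace ℝ (Fin n)))
    (x u : EuclideanSpace ℝ (Fin n)) : Prop :=
  ‖u‖ = 1 ∧ ∀ y ∈ K, inner ℝ y u ≤ inner ℝ x u

open Classical in
/-- The outer unit normal `n_x` of `K` at a regular boundary point `x`, that is, a point with exactly
one outer unit normal. At the other boundary points (for a convex set with non-empty interior they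
form a set of zero boundary measure) the value is irrelevant and is set to `0`. -/
noncomputable def outerUnitNormal {n : ℕ} (K : Set (EuclideanSpace ℝ (Fin n)))
    (x : EuclideanSpace ℝ (Fin n)) : EuclideanSpace ℝ (Fin n) :=
  if h : ∃! u, IsOuterUnitNormal K x u then h.choose else 0

theorem outerUnitNormal_eq {n : ℕ} {K : Set (EuclideanSpace ℝ (Fin n))}
    {x u : EuclideanSpace ℝ (Fin n)} (hu : IsOuterUnitNormal K x u)
    (huniq : ∀ w, IsOuterUnitNormal K x w → w = u) : outerUnitNormal K x = u := by
  have h : ∃! u, IsOuterUnitNormal K x u := ⟨u, hu, huniq⟩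
  rw [outerUnitNormal, dif_pos h]
  exact huniq _ h.choose_spec.1

/-- The boundary measure of `K ⊆ ℝⁿ`: the `(n-1)`-dimensional Hausdorff measure on `∂K`, normalized
so that it agrees with Lebesgue measure on `(n-1)`-dimensional subspaces. -/
noncomputable def boundaryMeasure {n : ℕ} (K : Set (EuclideanSpace ℝ (Fin n))) :
    Measure (EuclideanSpace ℝ (Fin n)) :=
  (μHE[n - 1] : Measure (EuclideanSpace ℝ (Fin n))).restrict (frontier K)

/-! Everything rests on one pointwise inequality. Let `u` be a unit outer normal at a boundary point
`x` and `h = ⟨x, u⟩`; by symmetry `K` lies in the slab `|⟨y, u⟩| ≤ h`. If `p u > 0`, Hahn–Banach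
gives `v` with `⟨u, v⟩ = p u` and `|⟨·, v⟩| ≤ p`. The interior of `K` lies in `slabCylinder K u v
h`, the part of the open slab on lines parallel to `v` through that interior. By Cauchy's projection
formula the volume of this cylinder is at most `(h / ⟨u, v⟩) ∫ |⟨n, v⟩|`, hence `p u * |K| ≤ h * ∫ p
n` (`seminorm_mul_measureReal_le`). Multiplying by `p u / (h * |K|)` and integrating over `x` gives
the theorem.

Only the upper bound in Cauchy's formula is needed (`volume_slabCylinder_le`). Almost every point of
the cylinder lies, after a translation, in a prism over a projected boundary piece. On a piece whose
normals are close to a fixed `u` the boundary is nearly flat, and the prism over it is nearly a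
linear image, with determinant `⟨u, v⟩`, of a right prism (`exists_volume_prism_le`). Summing over
countably many pieces gives the integral (`volume_prism_le_lintegral`). Almost everywhere uniqueness
of the normal comes from Rademacher's theorem.

Equality in the theorem forces the pointwise inequality to be an equality almost everywhere. One
point with `p u > 0` then suffices: the cylinder has the volume of `K`, so `closure K = C + [-cv,
cv]` with `c = h / ⟨u, v⟩`, and `p = |⟨·, v⟩|` at almost every normal. The normals span the space
and are `±u` or orthogonal to `v`, which determines `p` (`seminorm_eq_abs_inner`). The converse is a
computation on the two bases of the cylinder. -/

/-! ### Prisms and Hausdorff measure -/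

section Prism

open Module

variable {E : Type*} [NormedAddCommGroup E] [InnerProductSpace ℝ E]

/-- The union of the segments from `b` to `b + v`, over all `b ∈ B`. -/
def prism (B : Set E) (v : E) : Set E := {y | ∃ b ∈ B, ∃ s ∈ Set.Icc (0 : ℝ) 1, y = b + s • v}

theorem prism_iUnion {ι : Sort*} (A : ι → Set E) (v : E) :
    prism (⋃ i, A i) v = ⋃ i, prism (A i) v := by
  ext y
  simp only [prism, Set.mem_iUnion, Set.mem_ofPred_eq]
  constructor
  · rintro ⟨b, ⟨i, hb⟩, h⟩
    exact ⟨i, b, hb, h⟩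
  · rintro ⟨i, b, hb, h⟩
    exact ⟨b, ⟨i, hb⟩, h⟩

variable [FiniteDimensional ℝ E] [MeasurableSpace E] [BorelSpace E]

/-- Fubini for the splitting into the line of `u` and its orthogonal complement. The product formula
for rectangles holds for arbitrary sets, so `B` may be non-measurable; this matters later for
projected pieces of the boundary. -/
theorem volume_prism_orthogonal {u : E} (hu : ‖u‖ = 1) {B : Set E} (hB : ∀ b ∈ B, inner ℝ b u = 0) :
    volume (prism B u) = (μHE[finrank ℝ E - 1] : Measure E) B := by
  have hu0 : u ≠ 0 := fun h => by simp [h] at hu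
  set S : Submodule ℝ E := Submodule.span ℝ {u}
  have hrank : finrank ℝ Sᗮ = finrank ℝ E - 1 := by
    rw [← S.finrank_add_finrank_orthogonal, finrank_span_singleton hu0, Nat.add_sub_cancel_left]
  let e : ℝ ≃ₗᵢ[ℝ] S := LinearIsometryEquiv.toSpanUnitSingleton u hu
  let I : Set S := e '' Set.Icc 0 1
  let B' : Set Sᗮ := Subtype.val ⁻¹' B
  have he (s : ℝ) : (e s : E) = s • u := rfl
  have hI : volume I = 1 := by
    have : I = e.symm ⁻¹' Set.Icc 0 1 := by
      ext x; simp only [I, Set.mem_image, Set.mem_preimage]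
      constructor
      · rintro ⟨y, hy, rfl⟩; simpa using hy
      · intro h; exact ⟨_, h, by simp⟩
    rw [this, e.symm.measurePreserving.measure_preimage measurableSet_Icc.nullMeasurableSet]
    simp
  have hB' : (Subtype.val : Sᗮ → E) '' B' = B := by
    refine Set.image_preimage_eq_of_subset fun b hb => ?_
    rw [Subtype.range_coe]
    exact Submodule.mem_orthogonal_singleton_iff_inner_left.2 (hB b hb)
  have hpre : prism B u = S.measurableEquivProd (0 : E) ⁻¹' (I ×ˢ B') := by
    ext y
    have key : y = ((S.measurableEquivProd (0 : E) y).1 : E) + (S.measurableEquivProd (0 : E) y).2 := by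
      simp
    constructor
    · rintro ⟨b, hb, s, hs, rfl⟩
      have : S.measurableEquivProd (0 : E) (b + s • u) =
          (e s, ⟨b, Submodule.mem_orthogonal_singleton_iff_inner_left.2 (hB b hb)⟩) := by
        rw [← MeasurableEquiv.eq_symm_apply, Submodule.measurableEquivProd_symm_apply]
        simp [he, add_comm]
      rw [Set.mem_preimage, this]
      exact ⟨⟨s, hs, rfl⟩, hb⟩
    · rintro ⟨⟨s, hs, h1⟩, h2⟩
      refine ⟨_, h2, s, hs, ?_⟩
      rw [add_comm]
      conv_lhs => rw [key, ← h1]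
      rw [he]
  rw [← InnerProductSpace.euclideanHausdorffMeasure_eq_volume, hpre,
    (S.measurePreserving_measurableEquivProd (0 : E)).measure_preimage_equiv,
    Measure.volume_eq_prod, Measure.prod_prod, hI, one_mul,
    ← InnerProductSpace.euclideanHausdorffMeasure_eq_volume, hrank,
    ← Sᗮ.subtypeₗᵢ.isometry.euclideanHausdorffMeasure_image]
  exact congrArg _ hB'

theorem LipschitzOnWith.euclideanHausdorffMeasure_image_le {X Y : Type*} [EMetricSpace X]
    [MeasurableSpace X] [BorelSpace X] [EMetricSpace Y] [MeasurableSpace Y] [BorelSpace Y]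
    {C : NNReal} {f : X → Y} {s : Set X} (h : LipschitzOnWith C f s) (d : ℕ) :
    μHE[d] (f '' s) ≤ C ^ d * μHE[d] s := by
  have := h.hausdorffMeasure_image_le (d := d) (by positivity)
  simp only [Measure.euclideanHausdorffMeasure_def, Measure.smul_apply, ENNReal.smul_def, smul_eq_mul]
  rw [← mul_assoc, mul_comm ((C : ENNReal) ^ d), mul_assoc]
  gcongr
  simpa using this

end Prism

/-! ### Orthogonal projections and the volume of a prism over a nearly flat set -/

section Projection

open Module

variable {E : Type*} [NormedAddCommGroup E] [InnerProductSpace ℝ E]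

/-- The orthogonal projection along the unit vector `u`. -/
def projAlong (u : E) : E →ₗ[ℝ] E where
  toFun x := x - (inner ℝ x u : ℝ) • u
  map_add' x y := by rw [inner_add_left]; module
  map_smul' r x := by rw [inner_smul_left]; simp only [RCLike.conj_to_real, RingHom.id_apply]; module

theorem projAlong_apply (u x : E) : projAlong u x = x - (inner ℝ x u : ℝ) • u := rfl

theorem inner_projAlong {u : E} (hu : ‖u‖ = 1) (x : E) : inner ℝ (projAlong u x) u = 0 := by
  rw [projAlong_apply, inner_sub_left, inner_smul_left, real_inner_self_eq_norm_sq, hu]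
  simp

theorem projAlong_self {u : E} (hu : ‖u‖ = 1) : projAlong u u = 0 := by
  rw [projAlong_apply, real_inner_self_eq_norm_sq, hu]; simp

theorem projAlong_eq_self {u x : E} (h : inner ℝ x u = 0) : projAlong u x = x := by
  rw [projAlong_apply, h]; simp

theorem inner_projAlong_comm (u x y : E) :
    inner ℝ (projAlong u x) y = inner ℝ x (projAlong u y) := by
  simp only [projAlong_apply, inner_sub_left, inner_sub_right, inner_smul_left, inner_smul_right,
    RCLike.conj_to_real, real_inner_comm u y]
  ring

theorem norm_projAlong_le {u : E} (hu : ‖u‖ = 1) (x : E) : ‖projAlong u x‖ ≤ ‖x‖ := by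
  have h : x = projAlong u x + (inner ℝ x u : ℝ) • u := by rw [projAlong_apply]; simp
  have h2 : ‖x‖ ^ 2 = ‖projAlong u x‖ ^ 2 + (inner ℝ x u : ℝ) ^ 2 := by
    conv_lhs => rw [h]
    rw [norm_add_sq_real, inner_smul_right, inner_projAlong hu, norm_smul, hu]
    simp
  nlinarith [norm_nonneg x, norm_nonneg (projAlong u x), sq_nonneg (inner ℝ x u : ℝ)]

variable [MeasurableSpace E] [BorelSpace E]

theorem euclideanHausdorffMeasure_projAlong_image_le {u : E} (hu : ‖u‖ = 1) (d : ℕ) (A : Set E) :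
    (μHE[d] : Measure E) (projAlong u '' A) ≤ (μHE[d] : Measure E) A := by
  have : LipschitzOnWith 1 (projAlong u) A := by
    refine LipschitzOnWith.of_dist_le_mul fun x _ y _ => ?_
    rw [dist_eq_norm, dist_eq_norm, ← map_sub]
    simpa using norm_projAlong_le hu (x - y)
  simpa using this.euclideanHausdorffMeasure_image_le d

/-- The hypothesis makes `A` a graph of slope at most `k` over the hyperplane orthogonal to `u`, so
the inverse of the projection is `(1 + k)`-Lipschitz. -/
theorem euclideanHausdorffMeasure_le_projAlong_image {u : E} (hu : ‖u‖ = 1) (d : ℕ) {A : Set E}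
    {k : NNReal} (hA : ∀ x ∈ A, ∀ y ∈ A, |(inner ℝ (y - x) u : ℝ)| ≤ k * ‖projAlong u (y - x)‖) :
    (μHE[d] : Measure E) A ≤ (1 + k : NNReal) ^ d * (μHE[d] : Measure E) (projAlong u '' A) := by
  have hle (x) (hx : x ∈ A) (y) (hy : y ∈ A) : ‖y - x‖ ≤ (1 + k) * ‖projAlong u (y - x)‖ := by
    have h : y - x = projAlong u (y - x) + (inner ℝ (y - x) u : ℝ) • u := by
      rw [projAlong_apply]; simp
    calc ‖y - x‖ ≤ ‖projAlong u (y - x)‖ + ‖(inner ℝ (y - x) u : ℝ) • u‖ := by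
          conv_lhs => rw [h]
          exact norm_add_le _ _
      _ ≤ _ := by
          rw [norm_smul, hu, Real.norm_eq_abs]; linarith [hA x hx y hy]
  have hinj : Set.InjOn (projAlong u) A := by
    intro x hx y hy hxy
    have := hle x hx y hy
    rw [map_sub, hxy, sub_self, norm_zero, mul_zero] at this
    exact (sub_eq_zero.1 (norm_le_zero_iff.1 this)).symm
  rcases A.eq_empty_or_nonempty with rfl | hne
  · simp
  have : Nonempty E := ⟨hne.some⟩
  have hlip : LipschitzOnWith (1 + k) (Function.invFunOn (projAlong u) A) (projAlong u '' A) := by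
    refine LipschitzOnWith.of_dist_le_mul ?_
    rintro _ ⟨x, hx, rfl⟩ _ ⟨y, hy, rfl⟩
    rw [hinj.leftInvOn_invFunOn hx, hinj.leftInvOn_invFunOn hy, dist_eq_norm, dist_eq_norm,
      ← map_sub]
    exact hle y hy x hx
  have := hlip.euclideanHausdorffMeasure_image_le d
  rwa [hinj.leftInvOn_invFunOn.image_image] at this

variable [FiniteDimensional ℝ E]

/-- The infinitesimal form of Cauchy's projection formula. If `A` is nearly flat with normal `u`,
the prism over its image is the image of the right prism over the orthogonal projection of `A` under
a map that is close to linear with determinant `⟨u, v⟩`. -/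
theorem exists_volume_prism_le {u : E} (hu : ‖u‖ = 1) (v z : E) {m : NNReal}
    (hm : |(inner ℝ u v : ℝ)| < m) :
    ∃ δ : ℝ, 0 < δ ∧ ∀ A : Set E, (∀ x ∈ A, ∀ y ∈ A, |(inner ℝ (y - x) u : ℝ)| ≤ δ * ‖y - x‖) →
      volume (prism ((fun x : E => x - (inner ℝ x z : ℝ) • v) '' A) v) ≤
        m * (μHE[finrank ℝ E - 1] : Measure E) A := by
  -- The linear model: `T` sends `u` to `v` and agrees with `x ↦ x - ⟨x, z⟩ v` on the hyperplane
  -- orthogonal to `u`. It is a shear of determinant one followed by a transvection of determinant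
  -- `⟨u, v⟩`.
  let T : E →ₗ[ℝ] E := LinearMap.transvection (innerₗ E u) (v - u) ∘ₗ
    LinearMap.transvection (innerₗ E (-projAlong u z)) u
  have hT (y : E) : T y = projAlong u y +
      ((inner ℝ y u : ℝ) - (inner ℝ (projAlong u y) z : ℝ)) • v := by
    simp only [T, LinearMap.comp_apply, LinearMap.transvection.apply, innerₗ_apply_apply]
    rw [inner_projAlong_comm u y z, inner_neg_left, inner_add_right, inner_smul_right,
      real_inner_self_eq_norm_sq, hu, real_inner_comm y u, real_inner_comm y (projAlong u z),
      projAlong_apply u y]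
    module
  have hdet : LinearMap.det T = inner ℝ u v := by
    rw [LinearMap.det_comp, LinearMap.transvection.det, LinearMap.transvection.det]
    simp only [innerₗ_apply_apply, inner_neg_left, inner_projAlong hu, inner_sub_right,
      real_inner_self_eq_norm_sq, hu]
    ring
  obtain ⟨δ', hδ', hpos⟩ := ((addHaar_image_le_mul_of_det_lt (volume : Measure E)
    (LinearMap.toContinuousLinearMap T) (m := m) (by
      rw [ContinuousLinearMap.det, LinearMap.coe_toContinuousLinearMap, hdet]
      rw [ENNReal.ofReal_lt_coe_iff]
      · exact hm
      · exact abs_nonneg _)).and self_mem_nhdsWithin).exists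
  have hpos : (0 : ℝ) < δ' := hpos
  set c : ℝ := 1 + ‖z‖ * ‖v‖ with hc
  have hc0 : 0 < c := by positivity
  -- The bound `1 / 2` makes the projection along `u` injective on `A` with inverse 2-Lipschitz. The
  -- other bound absorbs this factor 2 and the factor `c ≥ ‖u - ⟨u, z⟩ v‖` in the deviation of `f`
  -- from `T`.
  refine ⟨min (1 / 2) (δ' / (2 * c)), by positivity, fun A hA => ?_⟩
  set δ := min (1 / 2) (δ' / (2 * c)) with hδ
  have hd1 : δ ≤ 1 / 2 := min_le_left _ _
  have hd2 : δ * (2 * c) ≤ δ' := by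
    rw [← le_div_iff₀ (by positivity)]; exact min_le_right _ _
  have hd0 : 0 < δ := by positivity
  have hle (x) (hx : x ∈ A) (y) (hy : y ∈ A) : ‖y - x‖ ≤ 2 * ‖projAlong u (y - x)‖ := by
    have h : y - x = projAlong u (y - x) + (inner ℝ (y - x) u : ℝ) • u := by
      rw [projAlong_apply]; simp
    have : ‖y - x‖ ≤ ‖projAlong u (y - x)‖ + |(inner ℝ (y - x) u : ℝ)| := by
      conv_lhs => rw [h]
      refine (norm_add_le _ _).trans_eq ?_
      rw [norm_smul, hu, Real.norm_eq_abs, mul_one]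
    nlinarith [hA x hx y hy, norm_nonneg (y - x)]
  have hinj : Set.InjOn (projAlong u) A := by
    intro x hx y hy hxy
    have := hle x hx y hy
    rw [map_sub, hxy, sub_self, norm_zero, mul_zero] at this
    exact (sub_eq_zero.1 (norm_le_zero_iff.1 this)).symm
  have : Nonempty E := ⟨u⟩
  have hproj (x : E) (s : ℝ) : projAlong u (projAlong u x + s • u) = projAlong u x := by
    rw [map_add, map_smul, projAlong_self hu, projAlong_eq_self (inner_projAlong hu x)]; simp
  have hin (x : E) (s : ℝ) : inner ℝ (projAlong u x + s • u) u = s := by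
    rw [inner_add_left, inner_projAlong hu, inner_smul_left, real_inner_self_eq_norm_sq, hu]; simp
  let a := Function.invFunOn (projAlong u) A
  -- The map lifts the foot of `y` back to `A`, applies `x ↦ x - ⟨x, z⟩ v`, and turns height along
  -- `u` into height along `v`.
  let f : E → E := fun y => a (projAlong u y) +
    ((inner ℝ y u : ℝ) - (inner ℝ (a (projAlong u y)) z : ℝ)) • v
  have hf (x) (hx : x ∈ A) (s : ℝ) : f (projAlong u x + s • u) =
      x + (s - (inner ℝ x z : ℝ)) • v := by
    simp only [f, hproj, hin]
    rw [show a (projAlong u x) = x from hinj.leftInvOn_invFunOn hx]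
  have happ : ApproximatesLinearOn f (LinearMap.toContinuousLinearMap T)
      (prism (projAlong u '' A) u) δ' := by
    rintro _ ⟨_, ⟨x, hx, rfl⟩, s, -, rfl⟩ _ ⟨_, ⟨y, hy, rfl⟩, t, -, rfl⟩
    rw [hf x hx, hf y hy, LinearMap.coe_toContinuousLinearMap', map_sub, hT, hT, hproj, hproj, hin,
      hin]
    have e1 : x + (s - (inner ℝ x z : ℝ)) • v - (y + (t - (inner ℝ y z : ℝ)) • v) -
        (projAlong u x + (s - (inner ℝ (projAlong u x) z : ℝ)) • v -
          (projAlong u y + (t - (inner ℝ (projAlong u y) z : ℝ)) • v)) =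
        (inner ℝ (x - y) u : ℝ) • (u - (inner ℝ u z : ℝ) • v) := by
      simp only [projAlong_apply, inner_sub_left, inner_smul_left, RCLike.conj_to_real]
      module
    rw [e1, norm_smul, Real.norm_eq_abs]
    have e2 : ‖u - (inner ℝ u z : ℝ) • v‖ ≤ c := by
      refine (norm_sub_le _ _).trans ?_
      rw [norm_smul, hu, Real.norm_eq_abs, hc]
      have := abs_real_inner_le_norm u z
      rw [hu, one_mul] at this
      gcongr
    have e3 : ‖projAlong u (x - y)‖ ≤ ‖projAlong u x + s • u - (projAlong u y + t • u)‖ := by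
      refine le_of_eq_of_le ?_ (norm_projAlong_le hu _)
      rw [map_sub, map_sub _ (_ + _), hproj, hproj]
    calc |(inner ℝ (x - y) u : ℝ)| * ‖u - (inner ℝ u z : ℝ) • v‖
        ≤ (δ * ‖x - y‖) * c := by gcongr; exact hA y hy x hx
      _ ≤ (δ * (2 * ‖projAlong u (x - y)‖)) * c := by gcongr; exact hle y hy x hx
      _ = δ * (2 * c) * ‖projAlong u (x - y)‖ := by ring
      _ ≤ _ := by gcongr
  have hsub : prism ((fun x : E => x - (inner ℝ x z : ℝ) • v) '' A) v ⊆
      f '' prism (projAlong u '' A) u := by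
    rintro _ ⟨_, ⟨x, hx, rfl⟩, s, hs, rfl⟩
    refine ⟨projAlong u x + s • u, ⟨_, ⟨x, hx, rfl⟩, s, hs, rfl⟩, ?_⟩
    rw [hf x hx]; module
  calc _ ≤ volume (f '' prism (projAlong u '' A) u) := measure_mono hsub
    _ ≤ m * volume (prism (projAlong u '' A) u) := hδ' _ _ happ
    _ = m * (μHE[finrank ℝ E - 1] : Measure E) (projAlong u '' A) := by
        rw [volume_prism_orthogonal hu]
        rintro _ ⟨x, -, rfl⟩
        exact inner_projAlong hu x
    _ ≤ _ := mul_le_mul' le_rfl (euclideanHausdorffMeasure_projAlong_image_le hu _ A)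

end Projection

/-! ### Cauchy's projection inequality for a set with supporting normals -/

section NormalField

open Module

variable {E : Type*} [NormedAddCommGroup E] [InnerProductSpace ℝ E]

/-- Each of the two points lies behind the hyperplane through the other one. When both normals are
within `δ` of `u`, this bounds the increment along `u` from above and from below. -/
theorem abs_inner_sub_le_of_normal_near {x y u w w' : E} {δ : ℝ} (h : inner ℝ (y - x) w ≤ (0 : ℝ))
    (h' : inner ℝ (x - y) w' ≤ (0 : ℝ)) (hw : ‖w - u‖ ≤ δ) (hw' : ‖w' - u‖ ≤ δ) :
    |(inner ℝ (y - x) u : ℝ)| ≤ δ * ‖y - x‖ := by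
  have key {a b : E} (hab : inner ℝ a b ≤ (0 : ℝ)) (hb : ‖b - u‖ ≤ δ) :
      (inner ℝ a u : ℝ) ≤ δ * ‖a‖ := by
    have h1 : (inner ℝ a u : ℝ) = inner ℝ a b - inner ℝ a (b - u) := by rw [inner_sub_right]; ring
    have h2 := (abs_le.1 (abs_real_inner_le_norm a (b - u))).1
    nlinarith [norm_nonneg a, mul_le_mul_of_nonneg_left hb (norm_nonneg a)]
  rw [abs_le]
  have h1 := key h hw
  have h2 := key h' hw'
  rw [norm_sub_rev x y, ← neg_sub y x, inner_neg_left] at h2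
  exact ⟨by linarith, h1⟩

variable [FiniteDimensional ℝ E]

theorem exists_seq_unit_cover {w₀ : E} (hw₀ : ‖w₀‖ = 1) {δ : E → ℝ} (hδ : ∀ u, ‖u‖ = 1 → 0 < δ u) :
    ∃ u : ℕ → E, (∀ k, ‖u k‖ = 1) ∧ ∀ w, ‖w‖ = 1 → ∃ k, ‖w - u k‖ < δ (u k) := by
  obtain ⟨t, hts, htc, hcov⟩ := TopologicalSpace.countable_cover_nhdsWithin
    (s := Metric.sphere (0 : E) 1) (f := fun u => Metric.ball u (δ u)) fun u hu =>
      mem_nhdsWithin_of_mem_nhds (Metric.ball_mem_nhds u (hδ u (by simpa using hu)))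
  have hne : t.Nonempty := by
    obtain ⟨u, hu, -⟩ := Set.mem_iUnion₂.1 (hcov (show w₀ ∈ Metric.sphere (0 : E) 1 by simpa))
    exact ⟨u, hu⟩
  obtain ⟨u, rfl⟩ := htc.exists_eq_range hne
  refine ⟨u, fun k => by simpa using hts ⟨k, rfl⟩, fun w hw => ?_⟩
  obtain ⟨_, ⟨k, rfl⟩, hk⟩ := Set.mem_iUnion₂.1 (hcov (show w ∈ Metric.sphere (0 : E) 1 by simpa))
  exact ⟨k, by simpa [dist_eq_norm] using hk⟩

variable [MeasurableSpace E] [BorelSpace E]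

/-- Null sets need no measurable partition, so neither `A` nor `ν` is assumed measurable. This
disposes of the exceptional boundary points, where normals are merely chosen. -/
theorem volume_prism_eq_zero (v z : E) {A : Set E} {ν : E → E} (hν : ∀ x ∈ A, ‖ν x‖ = 1)
    (hmono : ∀ x ∈ A, ∀ y ∈ A, inner ℝ (y - x) (ν x) ≤ (0 : ℝ))
    (hA : (μHE[finrank ℝ E - 1] : Measure E) A = 0) :
    volume (prism ((fun x : E => x - (inner ℝ x z : ℝ) • v) '' A) v) = 0 := by
  rcases A.eq_empty_or_nonempty with rfl | ⟨x₀, hx₀⟩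
  · simp [prism]
  have hex (u : E) : ∃ δ : ℝ, ‖u‖ = 1 → 0 < δ ∧ ∀ A : Set E,
      (∀ x ∈ A, ∀ y ∈ A, |(inner ℝ (y - x) u : ℝ)| ≤ δ * ‖y - x‖) →
      volume (prism ((fun x : E => x - (inner ℝ x z : ℝ) • v) '' A) v) ≤
        (‖(inner ℝ u v : ℝ)‖₊ + 1 : NNReal) * (μHE[finrank ℝ E - 1] : Measure E) A := by
    by_cases hu : ‖u‖ = 1
    · obtain ⟨δ, h⟩ := exists_volume_prism_le hu v z (m := ‖(inner ℝ u v : ℝ)‖₊ + 1) (by simp)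
      exact ⟨δ, fun _ => h⟩
    · exact ⟨0, fun h => absurd h hu⟩
  choose δ hδ using hex
  obtain ⟨u, hu, hcov⟩ := exists_seq_unit_cover (hν x₀ hx₀) fun u hu => (hδ u hu).1
  have hAU : A = ⋃ k, A ∩ {x | ‖ν x - u k‖ < δ (u k)} := by
    rw [← Set.inter_iUnion, eq_comm, Set.inter_eq_left]
    intro x hx
    obtain ⟨k, hk⟩ := hcov _ (hν x hx)
    exact Set.mem_iUnion.2 ⟨k, hk⟩
  rw [hAU, Set.image_iUnion, prism_iUnion, measure_iUnion_null_iff]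
  intro k
  refine le_antisymm (((hδ (u k) (hu k)).2 _ ?_).trans ?_) zero_le
  · rintro x ⟨hx, hxk⟩ y ⟨hy, hyk⟩
    exact abs_inner_sub_le_of_normal_near (hmono x hx y hy) (hmono y hy x hx) (le_of_lt hxk)
      (le_of_lt hyk)
  · rw [measure_mono_null Set.inter_subset_left hA, mul_zero]

theorem volume_prism_le_lintegral (v z : E) {A : Set E} {ν : E → E} (hA : MeasurableSet A)
    (hνm : Measurable ν) (hν : ∀ x ∈ A, ‖ν x‖ = 1)
    (hmono : ∀ x ∈ A, ∀ y ∈ A, inner ℝ (y - x) (ν x) ≤ (0 : ℝ))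
    (hfin : (μHE[finrank ℝ E - 1] : Measure E) A ≠ ⊤) :
    volume (prism ((fun x : E => x - (inner ℝ x z : ℝ) • v) '' A) v) ≤
      ∫⁻ x in A, ‖(inner ℝ (ν x) v : ℝ)‖ₑ ∂(μHE[finrank ℝ E - 1] : Measure E) := by
  rcases A.eq_empty_or_nonempty with rfl | ⟨x₀, hx₀⟩
  · simp [prism]
  set μ := (μHE[finrank ℝ E - 1] : Measure E)
  have main (η : NNReal) (hη : 0 < η) :
      volume (prism ((fun x : E => x - (inner ℝ x z : ℝ) • v) '' A) v) ≤
      (∫⁻ x in A, ‖(inner ℝ (ν x) v : ℝ)‖ₑ ∂μ) + (2 * η : NNReal) * μ A := by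
    -- The extra condition `δ * ‖v‖ ≤ η` ensures that replacing `u k` by a nearby normal `ν x`
    -- changes the inner product with `v` by at most `η`. With the `η` lost in the local estimate
    -- this makes `2 * η`.
    have hex (u : E) : ∃ δ : ℝ, ‖u‖ = 1 → (0 < δ ∧ δ * ‖v‖ ≤ η) ∧ ∀ A : Set E,
        (∀ x ∈ A, ∀ y ∈ A, |(inner ℝ (y - x) u : ℝ)| ≤ δ * ‖y - x‖) →
        volume (prism ((fun x : E => x - (inner ℝ x z : ℝ) • v) '' A) v) ≤
          (‖(inner ℝ u v : ℝ)‖₊ + η : NNReal) * μ A := by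
      by_cases hu : ‖u‖ = 1
      · obtain ⟨δ, h0, h⟩ := exists_volume_prism_le hu v z (m := ‖(inner ℝ u v : ℝ)‖₊ + η)
          (by simpa using hη)
        refine ⟨min δ (η / (‖v‖ + 1)), fun _ => ⟨⟨by positivity, ?_⟩, fun A hA => h A fun x hx y hy =>
          (hA x hx y hy).trans ?_⟩⟩
        · calc min δ (η / (‖v‖ + 1)) * ‖v‖ ≤ η / (‖v‖ + 1) * (‖v‖ + 1) := by
                gcongr
                · exact min_le_right _ _
                · linarith
            _ = η := by field_simp
        · gcongr; exact min_le_left _ _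
      · exact ⟨0, fun h => absurd h hu⟩
    choose δ hδ using hex
    obtain ⟨u, hu, hcov⟩ := exists_seq_unit_cover (hν x₀ hx₀) fun u hu => (hδ u hu).1.1
    let P : ℕ → Set E := disjointed fun k => {x | ‖ν x - u k‖ < δ (u k)}
    have hPsub (k) : P k ⊆ {x | ‖ν x - u k‖ < δ (u k)} := disjointed_subset _ k
    have hPm (k) : MeasurableSet (P k) := MeasurableSet.disjointed (fun k =>
      measurableSet_lt (hνm.sub_const _).norm measurable_const) k
    have hAU : A = ⋃ k, A ∩ P k := by
      rw [← Set.inter_iUnion, eq_comm, Set.inter_eq_left, iUnion_disjointed]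
      intro x hx
      obtain ⟨k, hk⟩ := hcov _ (hν x hx)
      exact Set.mem_iUnion.2 ⟨k, hk⟩
    have hdisj : Pairwise (Function.onFun Disjoint fun k => A ∩ P k) := fun i j hij =>
      ((disjoint_disjointed _) hij).mono Set.inter_subset_right Set.inter_subset_right
    calc volume (prism ((fun x : E => x - (inner ℝ x z : ℝ) • v) '' A) v)
        = volume (⋃ k, prism ((fun x : E => x - (inner ℝ x z : ℝ) • v) '' (A ∩ P k)) v) := by
          conv_lhs => rw [hAU, Set.image_iUnion, prism_iUnion]
      _ ≤ ∑' k, volume (prism ((fun x : E => x - (inner ℝ x z : ℝ) • v) '' (A ∩ P k)) v) :=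
          measure_iUnion_le _
      _ ≤ ∑' k, ∫⁻ x in A ∩ P k, (‖(inner ℝ (ν x) v : ℝ)‖ₑ + (2 * η : NNReal)) ∂μ := by
          refine ENNReal.tsum_le_tsum fun k => ((hδ (u k) (hu k)).2 _ ?_).trans ?_
          · rintro x ⟨hx, hxk⟩ y ⟨hy, hyk⟩
            exact abs_inner_sub_le_of_normal_near (hmono x hx y hy) (hmono y hy x hx)
              (le_of_lt (hPsub k hxk)) (le_of_lt (hPsub k hyk))
          · rw [← setLIntegral_const]
            refine setLIntegral_mono' (hA.inter (hPm k)) fun x hx => ?_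
            rw [enorm_eq_nnnorm, ← ENNReal.coe_add, ENNReal.coe_le_coe, ← NNReal.coe_le_coe]
            push_cast
            rw [Real.norm_eq_abs, Real.norm_eq_abs]
            have h1 : (inner ℝ (u k) v : ℝ) = inner ℝ (ν x) v - inner ℝ (ν x - u k) v := by
              rw [inner_sub_left]; ring
            have h2 := abs_real_inner_le_norm (ν x - u k) v
            have h3 : ‖ν x - u k‖ * ‖v‖ ≤ δ (u k) * ‖v‖ := by
              gcongr; exact le_of_lt (hPsub k hx.2)
            have h4 := (hδ (u k) (hu k)).1.2
            have h5 : |(inner ℝ (u k) v : ℝ)| ≤ |(inner ℝ (ν x) v : ℝ)| + |inner ℝ (ν x - u k) v| := by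
              rw [h1]; exact abs_sub _ _
            linarith
      _ = ∫⁻ x in A, (‖(inner ℝ (ν x) v : ℝ)‖ₑ + (2 * η : NNReal)) ∂μ := by
          conv_rhs => rw [hAU]
          rw [lintegral_iUnion (fun k => hA.inter (hPm k)) hdisj]
      _ = _ := by
          rw [lintegral_add_right _ measurable_const, setLIntegral_const]
  have : Filter.Tendsto (fun η : NNReal => (∫⁻ x in A, ‖(inner ℝ (ν x) v : ℝ)‖ₑ ∂μ) +
      ((2 * η : NNReal) : ENNReal) * μ A) (nhds 0)
      (nhds ((∫⁻ x in A, ‖(inner ℝ (ν x) v : ℝ)‖ₑ ∂μ) + ((2 * 0 : NNReal) : ENNReal) * μ A)) := by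
    refine tendsto_const_nhds.add (ENNReal.Tendsto.mul_const ?_ (Or.inr hfin))
    exact ENNReal.tendsto_coe.2 (Filter.tendsto_id.const_mul 2)
  simp only [mul_zero, ENNReal.coe_zero, zero_mul, add_zero] at this
  exact ge_of_tendsto (this.mono_left (nhdsWithin_le_nhds (s := Set.Ioi 0)))
    (Filter.eventually_of_mem self_mem_nhdsWithin main)

end NormalField

/-! ### Almost everywhere uniqueness of normals -/

section Rademacher

variable {E : Type*} [NormedAddCommGroup E] [InnerProductSpace ℝ E] [FiniteDimensional ℝ E]
  [MeasurableSpace E] [BorelSpace E]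

/-- A family of mutually supporting hyperplanes transversal to `u` supports itself in more than one
direction only over a null set of lines parallel to `u`. -/
theorem volume_lines_nonunique_normal {u : E} {κ R : ℝ} (hκ : 0 < κ) {F : Set (E × E)}
    (hF : ∀ f ∈ F, ‖f.1‖ ≤ R ∧ ‖f.2‖ = 1 ∧ κ ≤ inner ℝ u f.2)
    (hmono : ∀ f ∈ F, ∀ g ∈ F, inner ℝ (g.1 - f.1) f.2 ≤ (0 : ℝ)) :
    volume {y : E | ∃ x w w', (x, w) ∈ F ∧ (x, w') ∈ F ∧ w ≠ w' ∧ ∃ s : ℝ, y = x + s • u} = 0 := by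
  rcases F.eq_empty_or_nonempty with rfl | hne
  · simp
  have : Nonempty F := hne.to_subtype
  -- `g f y` is the signed distance, measured along `u`, from the hyperplane of `f` to `y`. The
  -- bound `κ` on transversality makes all these functions Lipschitz with the same constant.
  let g : F → E → ℝ := fun f y => inner ℝ (y - f.1.1) f.1.2 / inner ℝ u f.1.2
  have hpos (f : F) : 0 < (inner ℝ u f.1.2 : ℝ) := hκ.trans_le (hF f f.2).2.2
  have hglip (f : F) (y y' : E) : g f y ≤ g f y' + κ⁻¹ * ‖y - y'‖ := by
    have h1 : g f y = g f y' + inner ℝ (y - y') f.1.2 / inner ℝ u f.1.2 := by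
      simp only [g, ← add_div, ← inner_add_left]; congr 2; abel
    rw [h1]
    gcongr
    have h2 := (le_abs_self _).trans (abs_real_inner_le_norm (y - y') f.1.2)
    rw [(hF f f.2).2.1, mul_one] at h2
    rw [div_le_iff₀ (hpos f), inv_mul_eq_div, div_mul_eq_mul_div, le_div_iff₀ hκ]
    exact mul_le_mul h2 (hF f f.2).2.2 hκ.le (norm_nonneg _)
  have hbdd (y : E) : BddAbove (Set.range fun f => g f y) := by
    refine ⟨κ⁻¹ * (‖y‖ + R), ?_⟩
    rintro _ ⟨f, rfl⟩
    refine (hglip f y f.1.1).trans ?_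
    have h0 : g f f.1.1 = 0 := by simp [g]
    rw [h0, zero_add]
    gcongr
    exact (norm_sub_le _ _).trans (by gcongr; exact (hF f f.2).1)
  -- By mutual support the supremum at `x + s • u` is attained by every `f` in `F` based at `x`.
  -- Where `Θ` is differentiable, all these affine minorants have its gradient, so the unit normals
  -- coincide.
  let Θ : E → ℝ := fun y => ⨆ f, g f y
  have hlip : LipschitzWith (Real.toNNReal κ⁻¹) Θ := by
    refine LipschitzWith.of_le_add_mul _ fun y y' => ?_
    rw [Real.coe_toNNReal _ (by positivity), dist_eq_norm]
    exact ciSup_le fun f => (hglip f y y').trans (by gcongr; exact le_ciSup (hbdd y') f)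
  have hval (f : F) (s : ℝ) : Θ (f.1.1 + s • u) = s ∧ g f (f.1.1 + s • u) = s := by
    have h1 : g f (f.1.1 + s • u) = s := by
      simp only [g, add_sub_cancel_left, inner_smul_left]
      exact mul_div_cancel_right₀ _ (hpos f).ne'
    refine ⟨le_antisymm (ciSup_le fun f' => ?_) (h1.symm.trans_le (le_ciSup (hbdd _) f)), h1⟩
    have h2 := hmono f' f'.2 f f.2
    simp only [g]
    rw [div_le_iff₀ (hpos f'), add_sub_right_comm, inner_add_left, inner_smul_left]
    simpa using h2
  refine measure_mono_null ?_ (hlip.ae_differentiableAt (μ := volume))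
  rintro _ ⟨x, w, w', hw, hw', hne', s, rfl⟩ hdiff
  have key (w : E) (hw : (x, w) ∈ F) :
      fderiv ℝ Θ (x + s • u) = (inner ℝ u w : ℝ)⁻¹ • innerSL ℝ w := by
    have hg : HasFDerivAt (g ⟨_, hw⟩) ((inner ℝ u w : ℝ)⁻¹ • innerSL ℝ w) (x + s • u) := by
      have h := (((innerSL ℝ w).hasFDerivAt (x := x + s • u)).sub_const (inner ℝ w x)).const_smul
        (inner ℝ u w : ℝ)⁻¹
      refine h.congr_of_eventuallyEq (Filter.Eventually.of_forall fun y => ?_)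
      simp only [g, Pi.smul_apply, innerSL_apply_apply, smul_eq_mul, ← inner_sub_right]
      rw [real_inner_comm, div_eq_inv_mul]
    have hmin : IsLocalMin (fun y => Θ y - g ⟨_, hw⟩ y) (x + s • u) := by
      refine Filter.Eventually.of_forall fun y => ?_
      have := hval ⟨_, hw⟩ s
      simp only at this
      simp only [this.1, this.2, sub_self]
      exact sub_nonneg.2 (le_ciSup (hbdd y) _)
    exact sub_eq_zero.1 (hmin.hasFDerivAt_eq_zero (hdiff.hasFDerivAt.sub hg))
  have heq := (key w hw).symm.trans (key w' hw')
  have heq' : (inner ℝ u w : ℝ)⁻¹ • w = (inner ℝ u w' : ℝ)⁻¹ • w' := by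
    refine ext_inner_right ℝ fun z => ?_
    have := congrArg (fun L : E →L[ℝ] ℝ => L z) heq
    simpa [inner_smul_left] using this
  have ha := hpos ⟨_, hw⟩
  have hb := hpos ⟨_, hw'⟩
  simp only at ha hb
  have hn := congrArg norm heq'
  rw [norm_smul, norm_smul, (hF _ hw).2.1, (hF _ hw').2.1, mul_one, mul_one, Real.norm_eq_abs,
    Real.norm_eq_abs, abs_of_pos (inv_pos.2 ha), abs_of_pos (inv_pos.2 hb)] at hn
  rw [hn] at heq'
  exact hne' (smul_right_injective E (inv_pos.2 hb).ne' heq')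

end Rademacher

/-! ### The boundary of a convex body: finite area, regular points, measurable normal -/

section Boundary

variable {n : ℕ} {K : Set (EuclideanSpace ℝ (Fin n))} {r R : ℝ}

theorem exists_closedBall_subset_of_symm (hconv : Convex ℝ K) (hint : (interior K).Nonempty)
    (hsymm : ∀ x ∈ K, -x ∈ K) : ∃ r : ℝ, 0 < r ∧ Metric.closedBall 0 r ⊆ K := by
  obtain ⟨x, hx⟩ := hint
  have hneg : -K = K := by
    ext y
    exact ⟨fun h => by simpa using hsymm _ h, fun h => hsymm _ h⟩
  have hx' : -x ∈ interior K := by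
    have h : (Homeomorph.neg _) ⁻¹' interior K = interior ((Homeomorph.neg _) ⁻¹' K) :=
      (Homeomorph.neg (EuclideanSpace ℝ (Fin n))).preimage_interior K
    have h2 : (Homeomorph.neg (EuclideanSpace ℝ (Fin n))) ⁻¹' K = K := hneg
    rw [h2] at h
    have : x ∈ (Homeomorph.neg (EuclideanSpace ℝ (Fin n))) ⁻¹' interior K := by rwa [h]
    exact this
  have h0 : (0 : EuclideanSpace ℝ (Fin n)) ∈ interior K := by
    have := hconv.interior hx hx' (show (0 : ℝ) ≤ 1 / 2 by norm_num)
      (show (0 : ℝ) ≤ 1 / 2 by norm_num) (by norm_num)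
    simpa using this
  obtain ⟨r, hr, hsub⟩ := Metric.nhds_basis_closedBall.mem_iff.1 (mem_interior_iff_mem_nhds.1 h0)
  exact ⟨r, hr, hsub⟩

theorem exists_isOuterUnitNormal (hconv : Convex ℝ K) (hint : (interior K).Nonempty)
    {x : EuclideanSpace ℝ (Fin n)} (hx : x ∈ frontier K) : ∃ u, IsOuterUnitNormal K x u := by
  obtain ⟨f, hf⟩ := geometric_hahn_banach_open_point hconv.interior isOpen_interior hx.2
  set w := (InnerProductSpace.toDual ℝ (EuclideanSpace ℝ (Fin n))).symm f with hw
  have hfw (y) : f y = inner ℝ y w := by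
    rw [real_inner_comm, InnerProductSpace.toDual_symm_apply]
  obtain ⟨y₀, hy₀⟩ := hint
  have hw0 : w ≠ 0 := by
    intro h
    have := hf _ hy₀
    simp [hfw, h] at this
  have hle (y) (hy : y ∈ K) : f y ≤ f x := by
    have hy' : y ∈ closure (interior K) := by
      rw [hconv.closure_interior_eq_closure_of_nonempty_interior ⟨y₀, hy₀⟩]
      exact subset_closure hy
    exact closure_minimal (fun a ha => (hf a ha).le) (isClosed_le f.continuous continuous_const) hy'
  refine ⟨‖w‖⁻¹ • w, ?_, fun y hy => ?_⟩
  · rw [norm_smul, norm_inv, norm_norm, inv_mul_cancel₀ (norm_ne_zero_iff.2 hw0)]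
  · rw [inner_smul_right, inner_smul_right, ← hfw, ← hfw]
    exact mul_le_mul_of_nonneg_left (hle y hy) (by positivity)

theorem IsOuterUnitNormal.inner_le {x w : EuclideanSpace ℝ (Fin n)} (h : IsOuterUnitNormal K x w)
    {y : EuclideanSpace ℝ (Fin n)} (hy : y ∈ closure K) : inner ℝ y w ≤ (inner ℝ x w : ℝ) :=
  closure_minimal (t := {y | inner ℝ y w ≤ (inner ℝ x w : ℝ)}) h.2
    (isClosed_le (by fun_prop) continuous_const) hy

theorem IsOuterUnitNormal.le_inner {x w : EuclideanSpace ℝ (Fin n)} (h : IsOuterUnitNormal K x w)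
    (hr : 0 < r) (hball : Metric.closedBall 0 r ⊆ K) : r ≤ (inner ℝ x w : ℝ) := by
  have := h.2 (r • w) (hball (by simp [norm_smul, h.1, abs_of_pos hr]))
  rwa [inner_smul_left, real_inner_self_eq_norm_sq, h.1, one_pow, mul_one] at this

theorem norm_le_of_mem_frontier (hR : ∀ x ∈ K, ‖x‖ ≤ R) {x : EuclideanSpace ℝ (Fin n)}
    (hx : x ∈ frontier K) : ‖x‖ ≤ R :=
  closure_minimal (t := {x | ‖x‖ ≤ R}) hR (isClosed_le continuous_norm continuous_const) hx.1

/-- The radial direction makes an inner product of at least `r / R` with the normal. Moving by `r /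
(2 * R)` to `u` costs at most half of it. -/
theorem IsOuterUnitNormal.le_inner_of_near {x u w : EuclideanSpace ℝ (Fin n)}
    (h : IsOuterUnitNormal K x w) (hx : x ∈ frontier K) (hr : 0 < r)
    (hball : Metric.closedBall 0 r ⊆ K) (hR : ∀ x ∈ K, ‖x‖ ≤ R)
    (hnear : ‖‖x‖⁻¹ • x - u‖ ≤ r / (2 * R)) : r / (2 * R) ≤ (inner ℝ u w : ℝ) := by
  have hxw := h.le_inner hr hball
  have hxR := norm_le_of_mem_frontier hR hx
  have hx0 : 0 < ‖x‖ := by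
    have := real_inner_le_norm x w
    rw [h.1, mul_one] at this
    linarith
  have hR0 : 0 < R := hx0.trans_le hxR
  have h1 : (inner ℝ u w : ℝ) = ‖x‖⁻¹ * inner ℝ x w - inner ℝ (‖x‖⁻¹ • x - u) w := by
    rw [inner_sub_left, inner_smul_left]; simp
  have h2 := real_inner_le_norm (‖x‖⁻¹ • x - u) w
  rw [h.1, mul_one] at h2
  have h3 : r / R ≤ ‖x‖⁻¹ * inner ℝ x w := by
    rw [inv_mul_eq_div]
    exact div_le_div₀ (hr.le.trans hxw) hxw hx0 hxR
  have h4 : r / R = 2 * (r / (2 * R)) := by field_simp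
  linarith

/-- The part of the boundary seen from the origin in directions close to `u`. -/
def frontierNear (K : Set (EuclideanSpace ℝ (Fin n))) (κ : ℝ) (u : EuclideanSpace ℝ (Fin n)) :
    Set (EuclideanSpace ℝ (Fin n)) := {x ∈ frontier K | ‖‖x‖⁻¹ • x - u‖ ≤ κ}

theorem exists_finite_cover_frontierNear (hr : 0 < r) (hball : Metric.closedBall 0 r ⊆ K)
    {κ : ℝ} (hκ : 0 < κ) :
    ∃ t : Set (EuclideanSpace ℝ (Fin n)), t.Finite ∧ (∀ u ∈ t, ‖u‖ = 1) ∧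
      frontier K ⊆ ⋃ u ∈ t, frontierNear K κ u := by
  obtain ⟨t, hts, hfin, hcov⟩ :=
    (isCompact_sphere (0 : EuclideanSpace ℝ (Fin n)) 1).finite_cover_balls hκ
  refine ⟨t, hfin, fun u hu => by simpa using hts hu, fun x hx => ?_⟩
  have hx0 : x ≠ 0 := by
    rintro rfl
    exact hx.2 (mem_interior_iff_mem_nhds.2
      (Filter.mem_of_superset (Metric.closedBall_mem_nhds _ hr) hball))
  obtain ⟨u, hu, hxu⟩ := Set.mem_iUnion₂.1 (hcov (show ‖x‖⁻¹ • x ∈ Metric.sphere _ _ by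
    simp [norm_smul, hx0]))
  exact Set.mem_iUnion₂.2 ⟨u, hu, hx, by simpa [dist_eq_norm] using (le_of_lt hxu)⟩

/-- The piece is a Lipschitz graph over the hyperplane orthogonal to `u`: a normal `w` at `x`
satisfies `⟨y - x, w⟩ ≤ 0` and `⟨u, w⟩ ≥ r / (2 * R)`, which bounds the component of `y - x` along
`u` by its projection. Exchanging the points gives the other sign. -/
theorem abs_inner_le_of_mem_frontierNear (hconv : Convex ℝ K) (hr : 0 < r)
    (hball : Metric.closedBall 0 r ⊆ K) (hR : ∀ x ∈ K, ‖x‖ ≤ R) (hR0 : 0 < R)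
    {u x y : EuclideanSpace ℝ (Fin n)} (hx : x ∈ frontierNear K (r / (2 * R)) u)
    (hy : y ∈ frontierNear K (r / (2 * R)) u) :
    |(inner ℝ (y - x) u : ℝ)| ≤ (r / (2 * R))⁻¹ * ‖projAlong u (y - x)‖ := by
  have hint : (interior K).Nonempty := ⟨0, mem_interior_iff_mem_nhds.2
      (Filter.mem_of_superset (Metric.closedBall_mem_nhds _ hr) hball)⟩
  set κ := r / (2 * R)
  have hκ : 0 < κ := by positivity
  have key {x y : EuclideanSpace ℝ (Fin n)} (hx : x ∈ frontierNear K κ u)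
      (hy : y ∈ frontierNear K κ u) : inner ℝ (y - x) u ≤ κ⁻¹ * ‖projAlong u (y - x)‖ := by
    obtain ⟨w, hw⟩ := exists_isOuterUnitNormal hconv hint hx.1
    have h1 := hw.inner_le hy.1.1
    have h2 := hw.le_inner_of_near hx.1 hr hball hR hx.2
    have h3 : (inner ℝ (y - x) w : ℝ) =
        inner ℝ (projAlong u (y - x)) w + inner ℝ (y - x) u * inner ℝ u w := by
      rw [projAlong_apply, inner_sub_left (y - x), inner_smul_left]; simp
    have h4 := (abs_le.1 (abs_real_inner_le_norm (projAlong u (y - x)) w)).1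
    rw [hw.1, mul_one] at h4
    rw [inner_sub_left] at h3
    rw [inv_mul_eq_div, le_div_iff₀ hκ]
    rcases le_total (inner ℝ (y - x) u : ℝ) 0 with h | h
    · nlinarith [norm_nonneg (projAlong u (y - x))]
    · nlinarith
  rw [abs_le]
  have h1 := key hy hx
  rw [← neg_sub y x, inner_neg_left, map_neg, norm_neg] at h1
  exact ⟨by linarith, key hx hy⟩

theorem euclideanHausdorffMeasure_frontierNear_le (hconv : Convex ℝ K) (hr : 0 < r)
    (hball : Metric.closedBall 0 r ⊆ K) (hR : ∀ x ∈ K, ‖x‖ ≤ R) (hR0 : 0 < R)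
    {u : EuclideanSpace ℝ (Fin n)} (hu : ‖u‖ = 1) {A : Set (EuclideanSpace ℝ (Fin n))}
    (hA : A ⊆ frontierNear K (r / (2 * R)) u) :
    ∃ C : NNReal, (μHE[n - 1] : Measure (EuclideanSpace ℝ (Fin n))) A ≤
      C * volume (prism (projAlong u '' A) u) := by
  refine ⟨(1 + Real.toNNReal (r / (2 * R))⁻¹) ^ (n - 1), ?_⟩
  have h := euclideanHausdorffMeasure_le_projAlong_image hu (n - 1) (A := A)
    (k := Real.toNNReal (r / (2 * R))⁻¹) fun x hx y hy => by
      rw [Real.coe_toNNReal _ (by positivity)]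
      exact abs_inner_le_of_mem_frontierNear hconv hr hball hR hR0 (hA hx) (hA hy)
  rw [volume_prism_orthogonal hu, finrank_euclideanSpace_fin]
  · exact_mod_cast h
  · rintro _ ⟨x, -, rfl⟩
    exact inner_projAlong hu x

theorem euclideanHausdorffMeasure_frontier_lt_top (hconv : Convex ℝ K) (hr : 0 < r)
    (hball : Metric.closedBall 0 r ⊆ K) (hR : ∀ x ∈ K, ‖x‖ ≤ R) :
    (μHE[n - 1] : Measure (EuclideanSpace ℝ (Fin n))) (frontier K) < ⊤ := by
  -- In dimension zero `R` may vanish, so it is enlarged to stay positive.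
  have hR' : ∀ x ∈ K, ‖x‖ ≤ max R 1 := fun x hx => (hR x hx).trans (le_max_left _ _)
  have hR0 : 0 < max R 1 := lt_max_of_lt_right one_pos
  obtain ⟨t, hfin, hunit, hcov⟩ := exists_finite_cover_frontierNear hr hball
    (show 0 < r / (2 * max R 1) by positivity)
  refine (measure_mono hcov).trans_lt ?_
  refine measure_biUnion_lt_top hfin fun u hu => ?_
  obtain ⟨C, hC⟩ := euclideanHausdorffMeasure_frontierNear_le hconv hr hball hR' hR0 (hunit u hu)
    Set.Subset.rfl
  refine hC.trans_lt (ENNReal.mul_lt_top ENNReal.coe_lt_top ?_)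
  refine (measure_mono ?_).trans_lt (measure_closedBall_lt_top (x := 0) (r := max R 1 + 1))
  rintro _ ⟨_, ⟨x, hx, rfl⟩, s, hs, rfl⟩
  rw [mem_closedBall_zero_iff]
  refine (norm_add_le _ _).trans (add_le_add ((norm_projAlong_le (hunit u hu) x).trans
    (norm_le_of_mem_frontier hR' hx.1)) ?_)
  rw [norm_smul, hunit u hu, mul_one, Real.norm_eq_abs, abs_of_nonneg hs.1]
  exact hs.2

/-- On each graph piece, area is controlled by the volume of the right prism over the projection.
Over the irregular points this prism consists of lines that are null by
`volume_lines_nonunique_normal`. -/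
theorem euclideanHausdorffMeasure_nonunique_normal (hconv : Convex ℝ K) (hr : 0 < r)
    (hball : Metric.closedBall 0 r ⊆ K) (hR : ∀ x ∈ K, ‖x‖ ≤ R) :
    (μHE[n - 1] : Measure (EuclideanSpace ℝ (Fin n)))
      {x ∈ frontier K | ¬ ∃! u, IsOuterUnitNormal K x u} = 0 := by
  have hint : (interior K).Nonempty := ⟨0, mem_interior_iff_mem_nhds.2
      (Filter.mem_of_superset (Metric.closedBall_mem_nhds _ hr) hball)⟩
  have hR' : ∀ x ∈ K, ‖x‖ ≤ max R 1 := fun x hx => (hR x hx).trans (le_max_left _ _)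
  have hR0 : 0 < max R 1 := lt_max_of_lt_right one_pos
  have hκ : 0 < r / (2 * max R 1) := by positivity
  obtain ⟨t, hfin, hunit, hcov⟩ := exists_finite_cover_frontierNear hr hball hκ
  set N := {x ∈ frontier K | ¬ ∃! u, IsOuterUnitNormal K x u}
  refine measure_mono_null (t := ⋃ u ∈ t, N ∩ frontierNear K (r / (2 * max R 1)) u)
    (fun x hx => ?_) ((measure_biUnion_null_iff hfin.countable).2 fun u hu => ?_)
  · obtain ⟨u, hu, hxu⟩ := Set.mem_iUnion₂.1 (hcov hx.1)
    exact Set.mem_iUnion₂.2 ⟨u, hu, hx, hxu⟩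
  obtain ⟨C, hC⟩ := euclideanHausdorffMeasure_frontierNear_le hconv hr hball hR' hR0 (hunit u hu)
    (Set.inter_subset_right (s := N))
  refine le_antisymm (hC.trans ?_) zero_le
  rw [measure_mono_null _ (volume_lines_nonunique_normal (u := u) (R := max R 1) hκ
    (F := {f | f.1 ∈ frontierNear K (r / (2 * max R 1)) u ∧ IsOuterUnitNormal K f.1 f.2})
    ?_ ?_), mul_zero]
  · rintro _ ⟨_, ⟨x, ⟨hxN, hxu⟩, rfl⟩, s, -, rfl⟩
    obtain ⟨w, hw⟩ := exists_isOuterUnitNormal hconv hint hxN.1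
    have : ∃ w', IsOuterUnitNormal K x w' ∧ w' ≠ w := by
      by_contra! h
      exact hxN.2 ⟨w, hw, h⟩
    obtain ⟨w', hw', hne⟩ := this
    refine ⟨x, w', w, ⟨hxu, hw'⟩, ⟨hxu, hw⟩, hne, s - inner ℝ x u, ?_⟩
    rw [projAlong_apply]; module
  · rintro ⟨x, w⟩ ⟨hx, hw⟩
    exact ⟨norm_le_of_mem_frontier hR' hx.1, hw.1, hw.le_inner_of_near hx.1 hr hball hR' hx.2⟩
  · rintro ⟨x, w⟩ ⟨hx, hw⟩ ⟨y, w'⟩ ⟨hy, hw'⟩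
    rw [inner_sub_left, sub_nonpos]
    exact hw.inner_le hy.1.1

theorem isOuterUnitNormal_outerUnitNormal {x : EuclideanSpace ℝ (Fin n)}
    (h : ∃! u, IsOuterUnitNormal K x u) : IsOuterUnitNormal K x (outerUnitNormal K x) := by
  obtain ⟨u, hu, huniq⟩ := h
  rwa [outerUnitNormal_eq hu huniq]

/-- A cluster point of normals at points tending to `x` is again a normal at `x`. Compactness of the
sphere and uniqueness at `x` turn this into convergence. -/
theorem continuousOn_outerUnitNormal {A : Set (EuclideanSpace ℝ (Fin n))}
    (hA : ∀ x ∈ A, ∃! u, IsOuterUnitNormal K x u) : ContinuousOn (outerUnitNormal K) A := by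
  intro x hx
  refine (isCompact_sphere (0 : EuclideanSpace ℝ (Fin n)) 1).tendsto_nhds_of_unique_mapClusterPt
    (eventually_nhdsWithin_of_forall fun y hy => ?_) fun w hw hcl => ?_
  · simpa using (isOuterUnitNormal_outerUnitNormal (hA y hy)).1
  · refine (hA x hx).unique ⟨by simpa using hw, fun y hy => ?_⟩
      (isOuterUnitNormal_outerUnitNormal (hA x hx))
    obtain ⟨U, hU, hlim⟩ := mapClusterPt_iff_ultrafilter.1 hcl
    have hid : Filter.Tendsto id (U : Filter _) (nhds x) := hU.trans inf_le_left
    refine le_of_tendsto_of_tendsto (tendsto_const_nhds.inner hlim) (hid.inner hlim) ?_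
    exact Filter.eventually_of_mem (hU self_mem_nhdsWithin) fun a ha =>
      (isOuterUnitNormal_outerUnitNormal (hA a ha)).2 y hy

/-- Almost all of the boundary consists of regular points, and the outer unit normal is measurable
there. -/
theorem exists_measurable_regular (hconv : Convex ℝ K) (hr : 0 < r)
    (hball : Metric.closedBall 0 r ⊆ K) (hR : ∀ x ∈ K, ‖x‖ ≤ R) :
    ∃ A ⊆ frontier K, MeasurableSet A ∧ (∀ x ∈ A, ∃! u, IsOuterUnitNormal K x u) ∧
      (μHE[n - 1] : Measure (EuclideanSpace ℝ (Fin n))) (frontier K \ A) = 0 ∧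
      Measurable (A.indicator (outerUnitNormal K)) := by
  classical
  set N := {x ∈ frontier K | ¬ ∃! u, IsOuterUnitNormal K x u} with hN
  have hN0 : (μHE[n - 1] : Measure (EuclideanSpace ℝ (Fin n))) N = 0 :=
    euclideanHausdorffMeasure_nonunique_normal hconv hr hball hR
  have hreg : ∀ x ∈ frontier K \ toMeasurable μHE[n - 1] N, ∃! u, IsOuterUnitNormal K x u := by
    intro x hx
    by_contra h
    exact hx.2 (subset_toMeasurable _ _ ⟨hx.1, h⟩)
  have hm : MeasurableSet (frontier K \ toMeasurable μHE[n - 1] N) :=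
    isClosed_frontier.measurableSet.diff (measurableSet_toMeasurable _ _)
  refine ⟨frontier K \ toMeasurable μHE[n - 1] N, Set.sdiff_subset, hm, hreg, ?_, ?_⟩
  · rw [Set.sdiff_sdiff_right_self]
    exact measure_mono_null Set.inter_subset_right (by rw [measure_toMeasurable, hN0])
  · rw [← Set.piecewise_eq_indicator]
    exact (continuousOn_outerUnitNormal hreg).measurable_piecewise continuousOn_const hm

end Boundary

/-! ### The volume of the cylinder circumscribed along `v` -/

section SlabCylinder

variable {n : ℕ} {K : Set (EuclideanSpace ℝ (Fin n))} {r R : ℝ}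

theorem exists_exit_point (hbdd : Bornology.IsBounded K) {y v : EuclideanSpace ℝ (Fin n)}
    (hv : v ≠ 0) (hy : y ∈ interior K) : ∃ t : ℝ, 0 < t ∧ y + t • v ∈ frontier K := by
  have hcont : Continuous fun t : ℝ => y + t • v := by fun_prop
  set T : Set ℝ := {t | 0 ≤ t ∧ y + t • v ∈ closure K}
  have hT0 : (0 : ℝ) ∈ T := ⟨le_rfl, by simpa using subset_closure (interior_subset hy)⟩
  have hTc : IsClosed T := isClosed_Ici.inter (isClosed_closure.preimage hcont)
  have hTb : BddAbove T := by
    obtain ⟨R, hR⟩ := hbdd.closure.exists_norm_le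
    refine ⟨(R + ‖y‖) / ‖v‖, fun t ht => ?_⟩
    rw [le_div_iff₀ (norm_pos_iff.2 hv)]
    have h1 : ‖t • v‖ ≤ ‖y + t • v‖ + ‖y‖ := by
      simpa using norm_sub_le (y + t • v) y
    rw [norm_smul, Real.norm_eq_abs, abs_of_nonneg ht.1] at h1
    exact h1.trans (by gcongr; exact hR _ ht.2)
  have hmem : sSup T ∈ T := hTc.csSup_mem ⟨0, hT0⟩ hTb
  have hnot : y + sSup T • v ∉ interior K := by
    intro h
    have hn : (fun t : ℝ => y + t • v) ⁻¹' interior K ∈ nhds (sSup T) :=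
      hcont.continuousAt (isOpen_interior.mem_nhds h)
    obtain ⟨ε, hε, hball⟩ := Metric.mem_nhds_iff.1 hn
    have h2 : sSup T + ε / 2 ∈ T := by
      refine ⟨by linarith [hmem.1], subset_closure (interior_subset (hball ?_))⟩
      rw [Metric.mem_ball, Real.dist_eq, add_sub_cancel_left, abs_of_pos (by linarith)]
      linarith
    linarith [le_csSup hTb h2]
  refine ⟨sSup T, lt_of_le_of_ne hmem.1 fun h => hnot ?_, hmem.2, hnot⟩
  rw [← h]; simpa using hy

theorem IsOuterUnitNormal.inner_lt {x w y : EuclideanSpace ℝ (Fin n)}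
    (h : IsOuterUnitNormal K x w) (hy : y ∈ interior K) : inner ℝ y w < (inner ℝ x w : ℝ) := by
  obtain ⟨ε, hε, hball⟩ := Metric.nhds_basis_closedBall.mem_iff.1 (mem_interior_iff_mem_nhds.1 hy)
  have := h.2 (y + ε • w) (hball (by simp [norm_smul, h.1, abs_of_pos hε]))
  rw [inner_add_left, inner_smul_left, real_inner_self_eq_norm_sq, h.1] at this
  simp only [RCLike.conj_to_real, one_pow, mul_one] at this
  linarith

/-- The part of the open slab `|⟨x, u⟩| < h` on the lines parallel to `v` that meet the interior of
`K`. -/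
def slabCylinder (K : Set (EuclideanSpace ℝ (Fin n))) (u v : EuclideanSpace ℝ (Fin n)) (h : ℝ) :
    Set (EuclideanSpace ℝ (Fin n)) :=
  {x | |(inner ℝ x u : ℝ)| < h ∧ ∃ t : ℝ, x + t • v ∈ interior K}

theorem slabCylinder_neg (u v : EuclideanSpace ℝ (Fin n)) (h : ℝ) :
    slabCylinder K (-u) (-v) h = slabCylinder K u v h := by
  ext x
  simp only [slabCylinder, inner_neg_right, abs_neg, Set.mem_ofPred_eq]
  refine and_congr_right fun _ => ⟨?_, ?_⟩ <;>
  · rintro ⟨t, ht⟩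
    exact ⟨-t, by simpa using ht⟩

theorem isOpen_slabCylinder (u v : EuclideanSpace ℝ (Fin n)) (h : ℝ) :
    IsOpen (slabCylinder K u v h) := by
  refine IsOpen.inter (s := {x | |(inner ℝ x u : ℝ)| < h})
    (isOpen_lt (by fun_prop) continuous_const) ?_
  have : {x | ∃ t : ℝ, x + t • v ∈ interior K} = ⋃ t : ℝ, (fun x => x + t • v) ⁻¹' interior K := by
    ext x; simp
  change IsOpen {x | ∃ t : ℝ, x + t • v ∈ interior K}
  rw [this]
  exact isOpen_iUnion fun t => isOpen_interior.preimage (by fun_prop)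

theorem volume_slabCylinder_le_upper (hconv : Convex ℝ K) (hbdd : Bornology.IsBounded K)
    {A : Set (EuclideanSpace ℝ (Fin n))} (hA : A ⊆ frontier K) (hAm : MeasurableSet A)
    (hreg : ∀ x ∈ A, ∃! u, IsOuterUnitNormal K x u)
    (hnull : (μHE[n - 1] : Measure (EuclideanSpace ℝ (Fin n))) (frontier K \ A) = 0)
    (hfin : (μHE[n - 1] : Measure (EuclideanSpace ℝ (Fin n))) (frontier K) < ⊤)
    (hmeas : Measurable (A.indicator (outerUnitNormal K)))
    {u v : EuclideanSpace ℝ (Fin n)} (huv : 0 < (inner ℝ u v : ℝ)) {h : ℝ} (hh : 0 < h) :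
    volume (slabCylinder K u v h) ≤
      ∫⁻ x in A ∩ {x | 0 < (inner ℝ (A.indicator (outerUnitNormal K) x) v : ℝ)},
        ‖(inner ℝ (A.indicator (outerUnitNormal K) x) ((2 * (h / inner ℝ u v : ℝ)) • v) : ℝ)‖ₑ
        ∂(μHE[n - 1] : Measure (EuclideanSpace ℝ (Fin n))) := by
  rcases (slabCylinder K u v h).eq_empty_or_nonempty with hemp | ⟨x₀, -, t₀, ht₀⟩
  · simp [hemp]
  have hint : (interior K).Nonempty := ⟨_, ht₀⟩
  set ν := A.indicator (outerUnitNormal K) with hν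
  have hνA {x} (hx : x ∈ A) : IsOuterUnitNormal K x (ν x) := by
    rw [hν, Set.indicator_of_mem hx]; exact isOuterUnitNormal_outerUnitNormal (hreg x hx)
  set c : ℝ := h / inner ℝ u v with hc
  have hc0 : 0 < c := by positivity
  -- With this scaling `x ↦ x - ⟨x, z⟩ (2c v)` is the projection along `v` onto the hyperplane
  -- orthogonal to `u`; in particular it is constant on lines parallel to `v`.
  set z : EuclideanSpace ℝ (Fin n) := (2 * h)⁻¹ • u with hz
  set P : Set (EuclideanSpace ℝ (Fin n)) := A ∩ {x | 0 < (inner ℝ (ν x) v : ℝ)} with hP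
  set N : Set (EuclideanSpace ℝ (Fin n)) := frontier K \ A with hN
  have hchoose (x : EuclideanSpace ℝ (Fin n)) : ∃ w, x ∈ frontier K → IsOuterUnitNormal K x w := by
    by_cases hx : x ∈ frontier K
    · obtain ⟨w, hw⟩ := exists_isOuterUnitNormal hconv hint hx
      exact ⟨w, fun _ => hw⟩
    · exact ⟨0, fun h => absurd h hx⟩
  choose ω hω using hchoose
  have h1 := volume_prism_le_lintegral ((2 * c) • v) z (A := P) (ν := ν)
    (hAm.inter (measurableSet_lt measurable_const (hmeas.inner_const))) hmeas
    (fun x hx => (hνA hx.1).1)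
    (fun x hx y hy => by rw [inner_sub_left, sub_nonpos]; exact (hνA hx.1).inner_le (hA hy.1).1)
    (by rw [finrank_euclideanSpace_fin]
        exact ((measure_mono (Set.inter_subset_left.trans hA)).trans_lt hfin).ne)
  have h2 := volume_prism_eq_zero ((2 * c) • v) z (A := N) (ν := ω)
    (fun x hx => (hω x hx.1).1)
    (fun x hx y hy => by rw [inner_sub_left, sub_nonpos]; exact (hω x hx.1).inner_le hy.1.1)
    (by rw [finrank_euclideanSpace_fin]; exact hnull)
  rw [finrank_euclideanSpace_fin] at h1
  refine le_trans ?_ h1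
  set ρ : EuclideanSpace ℝ (Fin n) → EuclideanSpace ℝ (Fin n) :=
    fun x => x - (inner ℝ x z : ℝ) • (2 * c) • v with hρ
  have huv' : (inner ℝ v u : ℝ) = inner ℝ u v := real_inner_comm _ _
  have hρv (x : EuclideanSpace ℝ (Fin n)) (t : ℝ) : ρ (x + t • v) = ρ x := by
    have : (inner ℝ v z : ℝ) * (2 * c) = 1 := by
      rw [hz, inner_smul_right, huv', hc]; field_simp
    simp only [hρ, inner_add_left, inner_smul_left, RCLike.conj_to_real]
    rw [smul_smul, smul_smul, add_mul, mul_assoc t, this]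
    module
  -- A line parallel to `v` meets the slab in heights between `-c` and `c`; the translation moves
  -- these into the prism over the projected exit point. At a regular exit point the normal has
  -- positive product with `v`, because the line comes from the interior.
  have hsub : (fun x => c • v + x) '' slabCylinder K u v h ⊆
      prism (ρ '' P) ((2 * c) • v) ∪ prism (ρ '' N) ((2 * c) • v) := by
    rintro _ ⟨x, ⟨hxu, t, ht⟩, rfl⟩
    have hv0 : v ≠ 0 := by rintro rfl; simp at huv
    obtain ⟨s, hs, hfr⟩ := exists_exit_point hbdd hv0 ht
    have hρx : ρ (x + t • v + s • v) = ρ x := by rw [hρv, hρv]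
    have hmem : ∀ B : Set (EuclideanSpace ℝ (Fin n)), x + t • v + s • v ∈ B →
        c • v + x ∈ prism (ρ '' B) ((2 * c) • v) := by
      intro B hB
      refine ⟨_, ⟨_, hB, rfl⟩, inner ℝ x z + 1 / 2, ?_, ?_⟩
      · have hxz : |(inner ℝ x z : ℝ)| ≤ 1 / 2 := by
          rw [hz, inner_smul_right, abs_mul, abs_of_pos (by positivity), inv_mul_le_iff₀ (by positivity)]
          linarith
        rw [abs_le] at hxz
        exact ⟨by linarith, by linarith⟩
      · rw [hρx]; simp only [hρ]; module
    by_cases hxA : x + t • v + s • v ∈ A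
    · refine Or.inl (hmem P ⟨hxA, ?_⟩)
      have h3 := (hνA hxA).inner_lt ht
      rw [inner_add_left (x + t • v), inner_smul_left] at h3
      simp only [RCLike.conj_to_real, lt_add_iff_pos_right] at h3
      change 0 < (inner ℝ (ν (x + t • v + s • v)) v : ℝ)
      rw [real_inner_comm]
      exact pos_of_mul_pos_right h3 hs.le
    · exact Or.inr (hmem N ⟨hfr, hxA⟩)
  calc volume (slabCylinder K u v h)
      = volume ((fun x => c • v + x) '' slabCylinder K u v h) := by
        rw [Set.image_add_left, measure_preimage_add]
    _ ≤ _ := (measure_mono hsub).trans (measure_union_le _ _)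
    _ = _ := by rw [h2, add_zero]

/-- Exit points in directions `v` and `-v` give two bounds for the same cylinder over disjoint parts
of the boundary. Their sum gives the full integral and cancels the factor 2. -/
theorem volume_slabCylinder_le (hconv : Convex ℝ K) (hr : 0 < r)
    (hball : Metric.closedBall 0 r ⊆ K) (hR : ∀ x ∈ K, ‖x‖ ≤ R)
    {u v : EuclideanSpace ℝ (Fin n)} (huv : 0 < (inner ℝ u v : ℝ)) {h : ℝ} (hh : 0 < h) :
    volume (slabCylinder K u v h) ≤ ENNReal.ofReal (h / inner ℝ u v) *
      ∫⁻ x, ‖(inner ℝ (outerUnitNormal K x) v : ℝ)‖ₑ ∂boundaryMeasure K := by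
  have hbdd : Bornology.IsBounded K := isBounded_iff_forall_norm_le.2 ⟨R, hR⟩
  have hfin := euclideanHausdorffMeasure_frontier_lt_top hconv hr hball hR
  obtain ⟨A, hA, hAm, hreg, hnull, hmeas⟩ := exists_measurable_regular hconv hr hball hR
  have h1 := volume_slabCylinder_le_upper hconv hbdd hA hAm hreg hnull hfin hmeas huv hh
  have h2 := volume_slabCylinder_le_upper hconv hbdd hA hAm hreg hnull hfin hmeas
    (u := -u) (v := -v) (by simpa using huv) hh
  rw [slabCylinder_neg, inner_neg_neg] at h2
  set ν := A.indicator (outerUnitNormal K) with hν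
  set μ := (μHE[n - 1] : Measure (EuclideanSpace ℝ (Fin n)))
  set c : ℝ := h / inner ℝ u v with hc
  have hc0 : 0 < c := by positivity
  have hpull (t : ℝ) (x : EuclideanSpace ℝ (Fin n)) :
      ‖(inner ℝ (ν x) ((2 * t) • v) : ℝ)‖ₑ = 2 * ‖t‖ₑ * ‖(inner ℝ (ν x) v : ℝ)‖ₑ := by
    rw [inner_smul_right, enorm_mul, enorm_mul]
    simp [enorm_eq_nnnorm]
  simp only [smul_neg, inner_neg_right, enorm_neg, hpull] at h1 h2
  have hm : Measurable fun x => ‖(inner ℝ (ν x) v : ℝ)‖ₑ := hmeas.inner_const.enorm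
  rw [lintegral_const_mul _ hm] at h1 h2
  have hmP : MeasurableSet (A ∩ {x | 0 < -(inner ℝ (ν x) v : ℝ)}) :=
    hAm.inter (measurableSet_lt measurable_const hmeas.inner_const.neg)
  have hdisj : Disjoint (A ∩ {x | 0 < (inner ℝ (ν x) v : ℝ)})
      (A ∩ {x | 0 < -(inner ℝ (ν x) v : ℝ)}) := by
    rw [Set.disjoint_left]
    rintro x ⟨-, hx⟩ ⟨-, hx'⟩
    simp only [Set.mem_ofPred_eq] at hx hx'
    linarith
  have hsum := add_le_add h1 h2
  rw [← mul_add, ← lintegral_union hmP hdisj, ← two_mul, mul_assoc] at hsum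
  rw [ENNReal.mul_le_mul_iff_right two_ne_zero ENNReal.ofNat_ne_top] at hsum
  rw [← Real.enorm_of_nonneg hc0.le]
  refine hsum.trans (mul_le_mul' le_rfl ?_)
  calc _ ≤ ∫⁻ x in A, ‖(inner ℝ (ν x) v : ℝ)‖ₑ ∂μ :=
        lintegral_mono_set (Set.union_subset Set.inter_subset_left Set.inter_subset_left)
    _ = ∫⁻ x in A, ‖(inner ℝ (outerUnitNormal K x) v : ℝ)‖ₑ ∂μ :=
        setLIntegral_congr_fun hAm fun x hx => by simp only [hν, Set.indicator_of_mem hx]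
    _ ≤ _ := lintegral_mono_set hA

theorem aestronglyMeasurable_outerUnitNormal (hconv : Convex ℝ K) (hr : 0 < r)
    (hball : Metric.closedBall 0 r ⊆ K) (hR : ∀ x ∈ K, ‖x‖ ≤ R) :
    AEStronglyMeasurable (outerUnitNormal K) (boundaryMeasure K) := by
  obtain ⟨A, hA, hAm, hreg, hnull, hmeas⟩ := exists_measurable_regular hconv hr hball hR
  refine ⟨_, hmeas.stronglyMeasurable, ?_⟩
  rw [boundaryMeasure, Filter.EventuallyEq, ae_restrict_iff' isClosed_frontier.measurableSet,
    ae_iff]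
  refine measure_mono_null (fun x hx => ?_) hnull
  simp only [Set.mem_ofPred_eq, Classical.not_imp] at hx
  refine ⟨hx.1, fun hxA => hx.2 ?_⟩
  rw [Set.indicator_of_mem hxA]

theorem ae_existsUnique_isOuterUnitNormal (hconv : Convex ℝ K) (hr : 0 < r)
    (hball : Metric.closedBall 0 r ⊆ K) (hR : ∀ x ∈ K, ‖x‖ ≤ R) :
    ∀ᵐ x ∂boundaryMeasure K, x ∈ frontier K ∧ ∃! u, IsOuterUnitNormal K x u := by
  rw [boundaryMeasure, ae_restrict_iff' isClosed_frontier.measurableSet, ae_iff]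
  refine measure_mono_null (fun x hx => ?_)
    (euclideanHausdorffMeasure_nonunique_normal hconv hr hball hR)
  simp only [Set.mem_ofPred_eq, Classical.not_imp] at hx
  exact ⟨hx.1, fun h => hx.2 ⟨hx.1, h⟩⟩

theorem isFiniteMeasure_boundaryMeasure (hconv : Convex ℝ K) (hr : 0 < r)
    (hball : Metric.closedBall 0 r ⊆ K) (hR : ∀ x ∈ K, ‖x‖ ≤ R) :
    IsFiniteMeasure (boundaryMeasure K) :=
  ⟨by rw [boundaryMeasure, Measure.restrict_apply_univ]
      exact euclideanHausdorffMeasure_frontier_lt_top hconv hr hball hR⟩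

end SlabCylinder

/-! ### The pointwise inequality and its integral -/

section NormalIntegrals

variable {n : ℕ} {K : Set (EuclideanSpace ℝ (Fin n))} {r R : ℝ}

theorem Seminorm.continuous_euclideanSpace (p : Seminorm ℝ (EuclideanSpace ℝ (Fin n))) :
    Continuous p := p.convexOn.locallyLipschitz.continuous

/-- Hahn–Banach: a functional dominated by `p` and equal to `p` on `u`, represented by a vector. -/
theorem Seminorm.exists_inner_eq (p : Seminorm ℝ (EuclideanSpace ℝ (Fin n)))
    (u : EuclideanSpace ℝ (Fin n)) :
    ∃ v, (inner ℝ u v : ℝ) = p u ∧ ∀ x, |(inner ℝ x v : ℝ)| ≤ p x := by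
  obtain ⟨g, hg, hle⟩ : ∃ g : EuclideanSpace ℝ (Fin n) →ₗ[ℝ] ℝ, g u = p u ∧ ∀ x, g x ≤ p x := by
    by_cases hu : u = 0
    · exact ⟨0, by simp [hu], fun x => apply_nonneg p x⟩
    obtain ⟨g, hg, hle⟩ := exists_extension_of_le_sublinear (LinearPMap.mkSpanSingleton u (p u) hu) p
      (fun c hc x => by rw [map_smul_eq_mul, Real.norm_eq_abs, abs_of_pos hc])
      (fun x y => map_add_le_add p x y) (by
        rintro ⟨x, hx⟩
        obtain ⟨a, rfl⟩ := Submodule.mem_span_singleton.1 hx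
        rw [LinearPMap.mkSpanSingleton'_apply, map_smul_eq_mul, smul_eq_mul]
        simp only [RingHom.id_apply]
        exact mul_le_mul_of_nonneg_right (le_abs_self a) (apply_nonneg p u))
    refine ⟨g, ?_, hle⟩
    have := hg ⟨u, Submodule.mem_span_singleton_self u⟩
    rw [this]
    exact LinearPMap.mkSpanSingleton'_apply_self _ _ _ _
  refine ⟨(InnerProductSpace.toDual ℝ _).symm (LinearMap.toContinuousLinearMap g), ?_, fun x => ?_⟩
  · rw [real_inner_comm, InnerProductSpace.toDual_symm_apply]; exact hg
  · rw [real_inner_comm, InnerProductSpace.toDual_symm_apply, LinearMap.coe_toContinuousLinearMap']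
    refine abs_le.2 ⟨?_, hle x⟩
    have := hle (-x)
    rw [map_neg, map_neg_eq_map] at this
    linarith

theorem norm_outerUnitNormal_le (x : EuclideanSpace ℝ (Fin n)) : ‖outerUnitNormal K x‖ ≤ 1 := by
  by_cases h : ∃! u, IsOuterUnitNormal K x u
  · exact (isOuterUnitNormal_outerUnitNormal h).1.le
  · rw [outerUnitNormal, dif_neg h]; simp

theorem integrable_comp_outerUnitNormal (hconv : Convex ℝ K) (hr : 0 < r)
    (hball : Metric.closedBall 0 r ⊆ K) (hR : ∀ x ∈ K, ‖x‖ ≤ R)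
    {f : EuclideanSpace ℝ (Fin n) → ℝ} (hf : Continuous f) :
    Integrable (fun x => f (outerUnitNormal K x)) (boundaryMeasure K) := by
  have := isFiniteMeasure_boundaryMeasure hconv hr hball hR
  obtain ⟨C, hC⟩ := (isCompact_closedBall (0 : EuclideanSpace ℝ (Fin n)) 1).exists_bound_of_continuousOn
    hf.continuousOn
  refine Integrable.of_bound
    (hf.comp_aestronglyMeasurable (aestronglyMeasurable_outerUnitNormal hconv hr hball hR)) C
    (Filter.Eventually.of_forall fun x => hC _ (by simpa using norm_outerUnitNormal_le x))

theorem measureReal_interior (hconv : Convex ℝ K) :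
    volume.real (interior K) = volume.real K :=
  measureReal_congr (interior_ae_eq_of_null_frontier (hconv.addHaar_frontier volume))

theorem measureReal_pos_of_ball (hr : 0 < r) (hball : Metric.closedBall 0 r ⊆ K)
    (hR : ∀ x ∈ K, ‖x‖ ≤ R) : 0 < volume.real K := by
  have hfin : volume K ≠ ⊤ :=
    (isBounded_iff_forall_norm_le.2 ⟨R, hR⟩ : Bornology.IsBounded K).measure_lt_top.ne
  exact ENNReal.toReal_pos ((Metric.measure_closedBall_pos _ _ hr).trans_le
    (measure_mono hball)).ne' hfin

theorem interior_subset_slabCylinder {u v : EuclideanSpace ℝ (Fin n)} {h : ℝ}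
    (hh : ∀ y ∈ interior K, |(inner ℝ y u : ℝ)| < h) : interior K ⊆ slabCylinder K u v h :=
  fun y hy => ⟨hh y hy, 0, by simpa using hy⟩

theorem inner_mul_measureReal_slabCylinder_le (hconv : Convex ℝ K) (hr : 0 < r)
    (hball : Metric.closedBall 0 r ⊆ K) (hR : ∀ x ∈ K, ‖x‖ ≤ R)
    {u v : EuclideanSpace ℝ (Fin n)} (huv : 0 < (inner ℝ u v : ℝ)) {h : ℝ} (hh : 0 < h) :
    volume (slabCylinder K u v h) ≠ ⊤ ∧
    inner ℝ u v * volume.real (slabCylinder K u v h) ≤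
      h * ∫ x, |(inner ℝ (outerUnitNormal K x) v : ℝ)| ∂boundaryMeasure K := by
  have hle := volume_slabCylinder_le hconv hr hball hR huv hh
  have hi : Integrable (fun x => (inner ℝ (outerUnitNormal K x) v : ℝ)) (boundaryMeasure K) :=
    integrable_comp_outerUnitNormal hconv hr hball hR (f := fun y => inner ℝ y v) (by fun_prop)
  have htop := ENNReal.mul_ne_top (ENNReal.ofReal_ne_top (r := h / inner ℝ u v)) hi.2.ne
  refine ⟨ne_top_of_le_ne_top htop hle, ?_⟩
  have h2 := ENNReal.toReal_mono htop hle
  rw [ENNReal.toReal_mul, ENNReal.toReal_ofReal (by positivity),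
    ← integral_norm_eq_lintegral_enorm hi.1] at h2
  simp only [Real.norm_eq_abs] at h2
  rw [div_mul_eq_mul_div, le_div_iff₀ huv] at h2
  rw [mul_comm]; exact h2

theorem inner_mul_measureReal_le (hconv : Convex ℝ K) (hr : 0 < r)
    (hball : Metric.closedBall 0 r ⊆ K) (hR : ∀ x ∈ K, ‖x‖ ≤ R)
    {u v : EuclideanSpace ℝ (Fin n)} (huv : 0 < (inner ℝ u v : ℝ)) {h : ℝ}
    (hh : ∀ y ∈ interior K, |(inner ℝ y u : ℝ)| < h) :
    inner ℝ u v * volume.real K ≤ inner ℝ u v * volume.real (slabCylinder K u v h) ∧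
    inner ℝ u v * volume.real K ≤
      h * ∫ x, |(inner ℝ (outerUnitNormal K x) v : ℝ)| ∂boundaryMeasure K := by
  have h0 : 0 < h := (abs_nonneg _).trans_lt (hh 0 (mem_interior_iff_mem_nhds.2
      (Filter.mem_of_superset (Metric.closedBall_mem_nhds _ hr) hball)))
  obtain ⟨htop, hle⟩ := inner_mul_measureReal_slabCylinder_le hconv hr hball hR huv h0
  have : inner ℝ u v * volume.real K ≤ inner ℝ u v * volume.real (slabCylinder K u v h) := by
    rw [← measureReal_interior hconv]
    gcongr
    exact interior_subset_slabCylinder hh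
  exact ⟨this, this.trans hle⟩

theorem seminorm_mul_measureReal_le (hconv : Convex ℝ K) (hr : 0 < r)
    (hball : Metric.closedBall 0 r ⊆ K) (hR : ∀ x ∈ K, ‖x‖ ≤ R)
    (p : Seminorm ℝ (EuclideanSpace ℝ (Fin n))) {u : EuclideanSpace ℝ (Fin n)} {h : ℝ}
    (hh : ∀ y ∈ interior K, |(inner ℝ y u : ℝ)| < h) :
    p u * volume.real K ≤ h * ∫ x, p (outerUnitNormal K x) ∂boundaryMeasure K := by
  have h0 : 0 < h := (abs_nonneg _).trans_lt (hh 0 (mem_interior_iff_mem_nhds.2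
      (Filter.mem_of_superset (Metric.closedBall_mem_nhds _ hr) hball)))
  rcases (apply_nonneg p u).eq_or_lt with hpu | hpu
  · rw [← hpu, zero_mul]
    exact mul_nonneg h0.le (integral_nonneg fun x => apply_nonneg p _)
  obtain ⟨v, hv, hvp⟩ := p.exists_inner_eq u
  rw [← hv] at hpu ⊢
  refine (inner_mul_measureReal_le hconv hr hball hR hpu hh).2.trans ?_
  gcongr
  · exact integrable_comp_outerUnitNormal hconv hr hball hR (f := fun y => |inner ℝ y v|)
      (by fun_prop)
  · exact integrable_comp_outerUnitNormal hconv hr hball hR p.continuous_euclideanSpace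
  · exact fun x => hvp _

theorem abs_inner_lt_of_mem_interior (hR : ∀ x ∈ K, ‖x‖ ≤ R) (u : EuclideanSpace ℝ (Fin n)) :
    ∀ y ∈ interior K, |(inner ℝ y u : ℝ)| < R * ‖u‖ + 1 := fun y hy => by
  have h1 := abs_real_inner_le_norm y u
  have h2 := mul_le_mul_of_nonneg_right (hR y (interior_subset hy)) (norm_nonneg u)
  linarith

theorem integral_seminorm_pos (hconv : Convex ℝ K) (hr : 0 < r)
    (hball : Metric.closedBall 0 r ⊆ K) (hR : ∀ x ∈ K, ‖x‖ ≤ R)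
    {p : Seminorm ℝ (EuclideanSpace ℝ (Fin n))} (hp : p ≠ 0) :
    0 < ∫ x, p (outerUnitNormal K x) ∂boundaryMeasure K := by
  obtain ⟨u, hu⟩ : ∃ u, p u ≠ 0 := by
    by_contra! h
    exact hp (Seminorm.ext h)
  have hK := measureReal_pos_of_ball hr hball hR
  have h1 := seminorm_mul_measureReal_le hconv hr hball hR p (abs_inner_lt_of_mem_interior hR u)
  have h2 : 0 < p u := lt_of_le_of_ne (apply_nonneg p u) hu.symm
  have hR0 : 0 ≤ R := (norm_nonneg _).trans (hR 0 (hball (by simp [hr.le])))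
  exact pos_of_mul_pos_right ((mul_pos h2 hK).trans_le h1) (by positivity)

/-- The normals span the space: otherwise the projection of `K` along `w` would have zero area,
against the positive volume of `K`. -/
theorem eq_zero_of_ae_inner_outerUnitNormal_eq_zero (hconv : Convex ℝ K) (hr : 0 < r)
    (hball : Metric.closedBall 0 r ⊆ K) (hR : ∀ x ∈ K, ‖x‖ ≤ R) {w : EuclideanSpace ℝ (Fin n)}
    (hw : ∀ᵐ x ∂boundaryMeasure K, inner ℝ (outerUnitNormal K x) w = (0 : ℝ)) : w = 0 := by
  by_contra hw0
  have hpos : 0 < (inner ℝ w w : ℝ) := real_inner_self_pos.2 hw0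
  have h1 := (inner_mul_measureReal_le hconv hr hball hR hpos
    (abs_inner_lt_of_mem_interior hR w)).2
  rw [integral_eq_zero_of_ae (by filter_upwards [hw] with x hx; simp [hx]), mul_zero] at h1
  exact absurd h1 (not_le.2 (mul_pos hpos (measureReal_pos_of_ball hr hball hR)))

theorem IsOuterUnitNormal.abs_inner_lt (hsymm : ∀ x ∈ K, -x ∈ K)
    {x u : EuclideanSpace ℝ (Fin n)} (h : IsOuterUnitNormal K x u) :
    ∀ y ∈ interior K, |(inner ℝ y u : ℝ)| < inner ℝ x u := by
  intro y hy
  have h' : IsOuterUnitNormal K (-x) (-u) := by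
    refine ⟨by rw [norm_neg, h.1], fun y hy => ?_⟩
    have := h.2 _ (hsymm y hy)
    simpa using this
  have := h'.inner_lt hy
  rw [inner_neg_neg, inner_neg_right] at this
  exact abs_lt.2 ⟨by linarith, h.inner_lt hy⟩

/-- This is `seminorm_mul_measureReal_le` for `u` the normal at `x` and `h = ⟨x, u⟩`, multiplied by
`p u`. It yields both integrability and the integral inequality. -/
theorem ae_sq_div_le (hconv : Convex ℝ K) (hr : 0 < r)
    (hball : Metric.closedBall 0 r ⊆ K) (hR : ∀ x ∈ K, ‖x‖ ≤ R) (hsymm : ∀ x ∈ K, -x ∈ K)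
    (p : Seminorm ℝ (EuclideanSpace ℝ (Fin n))) :
    ∀ᵐ x ∂boundaryMeasure K,
      0 ≤ p (outerUnitNormal K x) ^ 2 / inner ℝ x (outerUnitNormal K x) ∧
      p (outerUnitNormal K x) ^ 2 / inner ℝ x (outerUnitNormal K x) ≤
        (∫ y, p (outerUnitNormal K y) ∂boundaryMeasure K) / volume.real K *
          p (outerUnitNormal K x) := by
  filter_upwards [ae_existsUnique_isOuterUnitNormal hconv hr hball hR] with x hx
  have hn := isOuterUnitNormal_outerUnitNormal hx.2
  have hpos := hr.trans_le (hn.le_inner hr hball)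
  have hK := measureReal_pos_of_ball hr hball hR
  refine ⟨by positivity, ?_⟩
  have h1 := seminorm_mul_measureReal_le hconv hr hball hR p (hn.abs_inner_lt hsymm)
  rw [div_mul_eq_mul_div, div_le_div_iff₀ hpos hK]
  nlinarith [apply_nonneg p (outerUnitNormal K x)]

theorem integrable_sq_div (hconv : Convex ℝ K) (hr : 0 < r)
    (hball : Metric.closedBall 0 r ⊆ K) (hR : ∀ x ∈ K, ‖x‖ ≤ R) (hsymm : ∀ x ∈ K, -x ∈ K)
    (p : Seminorm ℝ (EuclideanSpace ℝ (Fin n))) :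
    Integrable (fun x => p (outerUnitNormal K x) ^ 2 / inner ℝ x (outerUnitNormal K x))
      (boundaryMeasure K) := by
  have hN := aestronglyMeasurable_outerUnitNormal hconv hr hball hR
  refine ((integrable_comp_outerUnitNormal hconv hr hball hR p.continuous_euclideanSpace).const_mul
    ((∫ y, p (outerUnitNormal K y) ∂boundaryMeasure K) / volume.real K)).mono' ?_ ?_
  · exact (((p.continuous_euclideanSpace.comp_aestronglyMeasurable hN).pow 2).aemeasurable.div
      (aestronglyMeasurable_id.inner hN).aemeasurable).aestronglyMeasurable
  · filter_upwards [ae_sq_div_le hconv hr hball hR hsymm p] with x hx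
    rw [Real.norm_eq_abs, abs_of_nonneg hx.1]
    exact hx.2

theorem integral_sq_div_le (hconv : Convex ℝ K) (hr : 0 < r)
    (hball : Metric.closedBall 0 r ⊆ K) (hR : ∀ x ∈ K, ‖x‖ ≤ R) (hsymm : ∀ x ∈ K, -x ∈ K)
    (p : Seminorm ℝ (EuclideanSpace ℝ (Fin n))) :
    ∫ x, p (outerUnitNormal K x) ^ 2 / inner ℝ x (outerUnitNormal K x) ∂(boundaryMeasure K) ≤
      1 / volume.real K * (∫ x, p (outerUnitNormal K x) ∂(boundaryMeasure K)) ^ 2 := by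
  have hi := integrable_comp_outerUnitNormal hconv hr hball hR p.continuous_euclideanSpace
  refine (integral_mono_ae (integrable_sq_div hconv hr hball hR hsymm p) (hi.const_mul _)
    ((ae_sq_div_le hconv hr hball hR hsymm p).mono fun x hx => hx.2)).trans_eq ?_
  rw [integral_const_mul]; ring

end NormalIntegrals

/-! ### Cylinders, their normals and the form of the seminorm -/

section Cylinder

variable {n : ℕ} {K C : Set (EuclideanSpace ℝ (Fin n))} {r R c : ℝ}
  {u v : EuclideanSpace ℝ (Fin n)}

theorem mem_add_segment_neg_iff (hc : 0 < c) {x : EuclideanSpace ℝ (Fin n)} :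
    x ∈ C + segment ℝ (-(c • v)) (c • v) ↔ ∃ y ∈ C, ∃ s : ℝ, |s| ≤ c ∧ x = y + s • v := by
  rw [Set.mem_add]
  constructor
  · rintro ⟨y, hy, w, ⟨a, b, ha, hb, hab, rfl⟩, rfl⟩
    refine ⟨y, hy, (b - a) * c, ?_, by module⟩
    rw [abs_mul, abs_of_pos hc]
    refine mul_le_of_le_one_left hc.le (abs_le.2 ⟨by linarith, by linarith⟩)
  · rintro ⟨y, hy, s, hs, rfl⟩
    rw [abs_le] at hs
    refine ⟨y, hy, s • v, ⟨(c - s) / (2 * c), (c + s) / (2 * c), ?_, ?_, ?_, ?_⟩, rfl⟩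
    · exact div_nonneg (by linarith) (by linarith)
    · exact div_nonneg (by linarith) (by linarith)
    · field_simp; ring
    · rw [← smul_neg, smul_smul, smul_neg, ← neg_smul, smul_smul, ← add_smul]
      congr 1; field_simp; ring

/-- The projection onto `uᗮ` along `v`. -/
noncomputable def obliqueProj (u v : EuclideanSpace ℝ (Fin n)) :
    EuclideanSpace ℝ (Fin n) →ₗ[ℝ] EuclideanSpace ℝ (Fin n) :=
  LinearMap.transvection (-(inner ℝ u v : ℝ)⁻¹ • innerₗ _ u) v

theorem obliqueProj_apply (u v x : EuclideanSpace ℝ (Fin n)) :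
    obliqueProj u v x = x - ((inner ℝ x u : ℝ) / inner ℝ u v) • v := by
  simp only [obliqueProj, LinearMap.transvection.apply, LinearMap.smul_apply, innerₗ_apply_apply,
    smul_eq_mul]
  rw [real_inner_comm x u, div_eq_inv_mul]; module

theorem inner_obliqueProj (huv : (inner ℝ u v : ℝ) ≠ 0) (x : EuclideanSpace ℝ (Fin n)) :
    inner ℝ (obliqueProj u v x) u = (0 : ℝ) := by
  rw [obliqueProj_apply, inner_sub_left, inner_smul_left, real_inner_comm u v]
  simp only [RCLike.conj_to_real]
  field_simp; ring

theorem finrank_range_obliqueProj (huv : (inner ℝ u v : ℝ) ≠ 0) :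
    Module.finrank ℝ (LinearMap.range (obliqueProj u v)) + 1 = n := by
  have hker : LinearMap.ker (obliqueProj u v) = Submodule.span ℝ {v} := by
    ext x
    rw [LinearMap.mem_ker, obliqueProj_apply, Submodule.mem_span_singleton, sub_eq_zero]
    refine ⟨fun h => ⟨_, h.symm⟩, ?_⟩
    rintro ⟨a, rfl⟩
    rw [inner_smul_left, real_inner_comm u v]
    simp [huv]
  have h := LinearMap.finrank_range_add_finrank_ker (obliqueProj u v)
  rwa [hker, finrank_span_singleton (by rintro rfl; simp at huv), finrank_euclideanSpace_fin] at h

theorem closure_eq_obliqueProj_add_segment (hconv : Convex ℝ K) (hint : (interior K).Nonempty)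
    (huv : 0 < (inner ℝ u v : ℝ)) {h : ℝ} (hh : ∀ y ∈ interior K, |(inner ℝ y u : ℝ)| < h)
    (hsub : slabCylinder K u v h ⊆ closure K) :
    closure K = obliqueProj u v '' closure K +
      segment ℝ (-((h / inner ℝ u v : ℝ) • v)) ((h / inner ℝ u v : ℝ) • v) := by
  have h0 : 0 < h := (abs_nonneg _).trans_lt (hh _ hint.some_mem)
  have hc : 0 < h / (inner ℝ u v : ℝ) := by positivity
  set c := h / (inner ℝ u v : ℝ) with hcdef
  have hcl := hconv.closure_interior_eq_closure_of_nonempty_interior hint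
  ext x
  rw [mem_add_segment_neg_iff hc]
  constructor
  · intro hx
    refine ⟨_, ⟨x, hx, rfl⟩, (inner ℝ x u : ℝ) / inner ℝ u v, ?_, ?_⟩
    · rw [abs_div, abs_of_pos huv, hcdef]
      gcongr
      rw [← hcl] at hx
      exact closure_minimal (t := {x | |(inner ℝ x u : ℝ)| ≤ h}) (fun y hy => (hh y hy).le)
        (isClosed_le (by fun_prop) continuous_const) hx
    · rw [obliqueProj_apply]; module
  · rintro ⟨_, ⟨y, hy, rfl⟩, s, hs, rfl⟩
    have hcont : Continuous fun q : EuclideanSpace ℝ (Fin n) × ℝ =>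
        obliqueProj u v q.1 + q.2 • v :=
      (((obliqueProj u v).continuous_of_finiteDimensional.comp continuous_fst)).add
        (continuous_snd.smul continuous_const)
    -- The hypothesis on the slab cylinder covers interior points and heights strictly below `c`;
    -- the closed statement follows by continuity.
    have hmaps : Set.MapsTo (fun q : EuclideanSpace ℝ (Fin n) × ℝ => obliqueProj u v q.1 + q.2 • v)
        (interior K ×ˢ Set.Ioo (-c) c) (closure K) := by
      rintro ⟨y, s⟩ ⟨hy, hs⟩
      refine hsub ⟨?_, ?_⟩
      · simp only [inner_add_left, inner_obliqueProj huv.ne', inner_smul_left, RCLike.conj_to_real,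
          zero_add]
        rw [abs_mul, real_inner_comm u v, abs_of_pos huv, ← lt_div_iff₀ huv]
        exact abs_lt.2 hs
      · refine ⟨(inner ℝ y u : ℝ) / inner ℝ u v - s, ?_⟩
        convert! hy using 1
        simp only [obliqueProj_apply]; module
    have := (hmaps.closure hcont) (x := (y, s)) (by
      rw [closure_prod_eq, hcl, closure_Ioo (by linarith)]
      exact ⟨hy, abs_le.1 hs⟩)
    rwa [closure_closure] at this

/-- The part of the cylinder outside `closure K` is open and, by comparison of volumes, null; hence
it is empty. -/
theorem slabCylinder_subset_closure (hconv : Convex ℝ K) {h : ℝ}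
    (hh : ∀ y ∈ interior K, |(inner ℝ y u : ℝ)| < h) (htop : volume (slabCylinder K u v h) ≠ ⊤)
    (hvol : volume.real (slabCylinder K u v h) ≤ volume.real K) :
    slabCylinder K u v h ⊆ closure K := by
  have hop : IsOpen (slabCylinder K u v h \ closure K) :=
    (isOpen_slabCylinder u v h).sdiff isClosed_closure
  have hne : volume (slabCylinder K u v h \ closure K) ≠ ⊤ :=
    ne_top_of_le_ne_top htop (measure_mono Set.sdiff_subset)
  have hdisj : Disjoint (interior K) (slabCylinder K u v h \ closure K) :=
    Set.disjoint_left.2 fun x hx hx' => hx'.2 (subset_closure (interior_subset hx))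
  have hsub : interior K ∪ (slabCylinder K u v h \ closure K) ⊆ slabCylinder K u v h :=
    Set.union_subset (interior_subset_slabCylinder hh) Set.sdiff_subset
  have h1 := measureReal_mono hsub htop
  rw [measureReal_union hdisj hop.measurableSet
    (ne_top_of_le_ne_top htop (measure_mono (interior_subset_slabCylinder hh))) hne,
    measureReal_interior hconv] at h1
  have h2 : volume.real (slabCylinder K u v h \ closure K) = 0 :=
    le_antisymm (by linarith) measureReal_nonneg
  have h3 := (hop.measure_eq_zero_iff volume).1 ((measureReal_eq_zero_iff hne).1 h2)
  exact Set.sdiff_eq_empty.1 h3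

/-- Strictly inside a generating segment the normal can favour neither direction of `v`, so it is
orthogonal to `v`. At an end of the segment `u` or `-u` is a normal, hence the only one. -/
theorem normal_trichotomy_of_closure_eq (hc : 0 < c) (hu : ‖u‖ = 1) (huv : 0 < (inner ℝ u v : ℝ))
    (hCu : ∀ y ∈ C, inner ℝ y u = (0 : ℝ))
    (hK : closure K = C + segment ℝ (-(c • v)) (c • v)) {x : EuclideanSpace ℝ (Fin n)}
    (hx : x ∈ frontier K) (hreg : ∃! w, IsOuterUnitNormal K x w) :
    inner ℝ (outerUnitNormal K x) v = (0 : ℝ) ∨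
      (outerUnitNormal K x = u ∧ ∃ y ∈ C, x = y + c • v) ∨
      (outerUnitNormal K x = -u ∧ ∃ y ∈ C, x = y + (-c) • v) := by
  have hn := isOuterUnitNormal_outerUnitNormal hreg
  set N := outerUnitNormal K x
  have hbound (y) (hy : y ∈ K) : |(inner ℝ y u : ℝ)| ≤ c * inner ℝ u v := by
    have hy' := subset_closure hy
    rw [hK, mem_add_segment_neg_iff hc] at hy'
    obtain ⟨a, ha, s, hs, rfl⟩ := hy'
    rw [inner_add_left, hCu a ha, inner_smul_left, zero_add, real_inner_comm u v, abs_mul,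
      abs_of_pos huv]
    simp only [RCLike.conj_to_real]
    gcongr
  have hx' := hx.1
  rw [hK, mem_add_segment_neg_iff hc] at hx'
  obtain ⟨y, hy, s, hs, hxy⟩ := hx'
  have hxu : (inner ℝ x u : ℝ) = s * inner ℝ u v := by
    rw [hxy, inner_add_left, hCu y hy, inner_smul_left, zero_add, real_inner_comm u v]; rfl
  have hmem (t : ℝ) (ht : |t| ≤ c) : y + t • v ∈ closure K := by
    rw [hK, mem_add_segment_neg_iff hc]; exact ⟨y, hy, t, ht, rfl⟩
  have hle (t : ℝ) (ht : |t| ≤ c) : (t - s) * (inner ℝ N v : ℝ) ≤ 0 := by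
    have h1 := hn.inner_le (hmem t ht)
    rw [hxy, inner_add_left, inner_add_left, inner_smul_left, inner_smul_left,
      real_inner_comm N v] at h1
    simp only [RCLike.conj_to_real] at h1
    linarith
  have h1 := hle c (abs_of_pos hc).le
  have h2 := hle (-c) (by rw [abs_neg, abs_of_pos hc])
  rw [abs_le] at hs
  by_cases hsc : s = c
  · refine Or.inr (Or.inl ⟨hreg.unique hn ⟨hu, fun y hy => ?_⟩, y, hy, by rw [hxy, hsc]⟩)
    rw [hxu, hsc]
    exact (le_abs_self _).trans (hbound y hy)
  by_cases hsc' : s = -c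
  · refine Or.inr (Or.inr ⟨hreg.unique hn ⟨by rw [norm_neg, hu], fun y hy => ?_⟩, y, hy,
      by rw [hxy, hsc']⟩)
    rw [inner_neg_right, inner_neg_right, hxu, hsc']
    have := (neg_le_abs _).trans (hbound y hy)
    linarith
  · have hs1 : s < c := lt_of_le_of_ne hs.2 hsc
    have hs2 : -c < s := lt_of_le_of_ne hs.1 (Ne.symm hsc')
    left
    refine le_antisymm ?_ ?_ <;> by_contra! h <;> nlinarith

theorem seminorm_eq_abs_inner (hconv : Convex ℝ K) (hr : 0 < r)
    (hball : Metric.closedBall 0 r ⊆ K) (hR : ∀ x ∈ K, ‖x‖ ≤ R)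
    {p : Seminorm ℝ (EuclideanSpace ℝ (Fin n))} (huv : 0 < (inner ℝ u v : ℝ))
    (hpu : p u = inner ℝ u v)
    (hp : ∀ᵐ x ∂boundaryMeasure K,
      p (outerUnitNormal K x) = |(inner ℝ (outerUnitNormal K x) v : ℝ)|)
    (hN : ∀ᵐ x ∂boundaryMeasure K, inner ℝ (outerUnitNormal K x) v = (0 : ℝ) ∨
      outerUnitNormal K x = u ∨ outerUnitNormal K x = -u) (x : EuclideanSpace ℝ (Fin n)) :
    p x = |(inner ℝ x v : ℝ)| := by
  let V : Submodule ℝ (EuclideanSpace ℝ (Fin n)) := (Submodule.span ℝ {v})ᗮ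
  let W : Submodule ℝ (EuclideanSpace ℝ (Fin n)) :=
    { carrier := {y | p y = 0 ∧ inner ℝ y v = (0 : ℝ)}
      zero_mem' := by simp
      add_mem' := fun {a b} ha hb => ⟨le_antisymm ((map_add_le_add p a b).trans
        (by rw [ha.1, hb.1, add_zero])) (apply_nonneg p _), by
          rw [inner_add_left, ha.2, hb.2, add_zero]⟩
      smul_mem' := fun a y hy => ⟨by rw [map_smul_eq_mul, hy.1, mul_zero], by
        rw [inner_smul_left, hy.2, mul_zero]⟩ }
  have hV {y : EuclideanSpace ℝ (Fin n)} : y ∈ V ↔ inner ℝ y v = (0 : ℝ) :=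
    Submodule.mem_orthogonal_singleton_iff_inner_left
  have hWV : W ≤ V := fun y hy => hV.2 hy.2
  -- For `w` in both spaces, `w - l • v` with `l` chosen to kill the product with `u` is orthogonal
  -- to almost every normal, so it vanishes; as `w` is orthogonal to `v`, it vanishes too. Thus `p`
  -- is zero on all of the hyperplane orthogonal to `v`, and its value at `u` determines it.
  have hbot : Wᗮ ⊓ V = ⊥ := by
    rw [eq_bot_iff]
    rintro w ⟨hwW, hwV⟩
    have hwv : inner ℝ w v = (0 : ℝ) := hV.1 hwV
    set l : ℝ := inner ℝ w u / inner ℝ u v with hl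
    have hae : ∀ᵐ x ∂boundaryMeasure K, inner ℝ (outerUnitNormal K x) (w - l • v) = (0 : ℝ) := by
      have hu0 : inner ℝ u (w - l • v) = (0 : ℝ) := by
        rw [inner_sub_right, inner_smul_right, hl, div_mul_cancel₀ _ huv.ne', real_inner_comm,
          sub_self]
      filter_upwards [hp, hN] with x hpx hNx
      rcases hNx with h | h | h
      · have hmem : outerUnitNormal K x ∈ W := ⟨by rw [hpx, h, abs_zero], h⟩
        rw [inner_sub_right, inner_smul_right, h, mul_zero, sub_zero]
        exact (Submodule.mem_orthogonal _ _).1 hwW _ hmem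
      · rw [h, hu0]
      · rw [h, inner_neg_left, hu0, neg_zero]
    have h0 := eq_zero_of_ae_inner_outerUnitNormal_eq_zero hconv hr hball hR hae
    have h1 : (inner ℝ w w : ℝ) = 0 := by
      have := congrArg (fun y => (inner ℝ w y : ℝ)) h0
      simpa [inner_sub_right, inner_smul_right, hwv] using this
    exact inner_self_eq_zero.1 h1
  have hWVeq : W = V := by
    have := Submodule.sup_orthogonal_inf_of_hasOrthogonalProjection hWV
    rwa [hbot, sup_bot_eq] at this
  set l : ℝ := inner ℝ x v / inner ℝ u v with hl
  have hmem : x - l • u ∈ W := by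
    rw [hWVeq, hV, inner_sub_left, inner_smul_left, hl]
    simp only [RCLike.conj_to_real]
    rw [div_mul_cancel₀ _ huv.ne', sub_self]
  have hpl : p (l • u) = |(inner ℝ x v : ℝ)| := by
    rw [map_smul_eq_mul, hpu, Real.norm_eq_abs, hl, abs_div, abs_of_pos huv,
      div_mul_cancel₀ _ huv.ne']
  have h1 : p x ≤ p (x - l • u) + p (l • u) := by
    simpa using map_add_le_add p (x - l • u) (l • u)
  have h2 : p (l • u) ≤ p x + p (x - l • u) := by
    have := map_sub_le_add p x (x - l • u)
    simpa using this
  rw [hmem.1] at h1 h2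
  rw [← hpl]
  linarith

end Cylinder

/-! ### The equality case -/

section Equality

variable {n : ℕ} {K C : Set (EuclideanSpace ℝ (Fin n))} {r R c : ℝ}
  {u v : EuclideanSpace ℝ (Fin n)}

theorem euclideanHausdorffMeasure_base_le (hconv : Convex ℝ K) (hc : 0 < c) (hu : ‖u‖ = 1)
    (huv : 0 < (inner ℝ u v : ℝ)) (hCu : ∀ y ∈ C, inner ℝ y u = (0 : ℝ))
    (hK : closure K = C + segment ℝ (-(c • v)) (c • v)) :
    ENNReal.ofReal (2 * c * inner ℝ u v) *
      (μHE[n - 1] : Measure (EuclideanSpace ℝ (Fin n))) C ≤ volume K := by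
  -- `T` fixes the hyperplane orthogonal to `u` and sends `u` to `2c v`, so it carries the right
  -- prism over `C` into the cylinder translated by `c v`.
  let T := LinearMap.transvection (innerₗ (EuclideanSpace ℝ (Fin n)) u) ((2 * c) • v - u)
  have hdet : LinearMap.det T = 2 * c * inner ℝ u v := by
    simp only [T, LinearMap.transvection.det, innerₗ_apply_apply, inner_sub_right,
      inner_smul_right, real_inner_self_eq_norm_sq, hu]
    ring
  have himg : T '' prism C u ⊆ (fun x => c • v + x) '' closure K := by
    rintro _ ⟨_, ⟨y, hy, s, hs, rfl⟩, rfl⟩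
    refine ⟨y + ((2 * s - 1) * c) • v, ?_, ?_⟩
    · rw [hK, mem_add_segment_neg_iff hc]
      refine ⟨y, hy, _, ?_, rfl⟩
      rw [abs_mul, abs_of_pos hc]
      exact mul_le_of_le_one_left hc.le (abs_le.2 ⟨by linarith [hs.1], by linarith [hs.2]⟩)
    · simp only [T, LinearMap.transvection.apply, innerₗ_apply_apply, inner_add_right,
        inner_smul_right, real_inner_self_eq_norm_sq, hu, real_inner_comm y u, hCu y hy]
      module
  calc _ = volume (T '' prism C u) := by
        rw [Measure.addHaar_image_linearMap, hdet, abs_of_pos (by positivity),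
          volume_prism_orthogonal hu hCu, finrank_euclideanSpace_fin]
    _ ≤ volume ((fun x => c • v + x) '' closure K) := measure_mono himg
    _ = volume (closure K) := by rw [Set.image_add_left, measure_preimage_add]
    _ = volume K :=
        measure_congr (closure_ae_eq_of_null_frontier (hconv.addHaar_frontier volume))

/-- The integrand is `⟨u, v⟩` on the two bases and vanishes at almost all other boundary points. So
the integral is at most `2 ⟨u, v⟩` times the area of `C`, while the volume is at least `2c ⟨u, v⟩`
times that area. -/
theorem integral_seminorm_le_of_cylinder (hconv : Convex ℝ K) (hr : 0 < r)
    (hball : Metric.closedBall 0 r ⊆ K) (hR : ∀ x ∈ K, ‖x‖ ≤ R)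
    {p : Seminorm ℝ (EuclideanSpace ℝ (Fin n))} (hp : ∀ x, p x = |(inner ℝ x v : ℝ)|)
    (hc : 0 < c) (hu : ‖u‖ = 1) (huv : 0 < (inner ℝ u v : ℝ))
    (hCu : ∀ y ∈ C, inner ℝ y u = (0 : ℝ))
    (hK : closure K = C + segment ℝ (-(c • v)) (c • v)) :
    c * ∫ x, p (outerUnitNormal K x) ∂boundaryMeasure K ≤ volume.real K := by
  set μ := (μHE[n - 1] : Measure (EuclideanSpace ℝ (Fin n))) with hμ
  have hbase := euclideanHausdorffMeasure_base_le hconv hc hu huv hCu hK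
  have hKfin : volume K ≠ ⊤ :=
    (isBounded_iff_forall_norm_le.2 ⟨R, hR⟩ : Bornology.IsBounded K).measure_lt_top.ne
  have hCcl : IsClosed C := by
    have : C = closure K ∩ {x | inner ℝ x u = (0 : ℝ)} := by
      ext x
      rw [Set.mem_inter_iff, hK, mem_add_segment_neg_iff hc]
      constructor
      · intro hx
        exact ⟨⟨x, hx, 0, by simpa using hc.le, by simp⟩, hCu x hx⟩
      · rintro ⟨⟨y, hy, s, hs, rfl⟩, hx⟩
        have hx : inner ℝ (y + s • v) u = (0 : ℝ) := hx
        rw [inner_add_left, hCu y hy, inner_smul_left, zero_add, real_inner_comm u v] at hx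
        have hs0 : s = 0 := (mul_eq_zero.1 hx).resolve_right huv.ne'
        simpa [hs0] using hy
    rw [this]
    exact isClosed_closure.inter (isClosed_eq (by fun_prop) continuous_const)
  let B : Set (EuclideanSpace ℝ (Fin n)) := (fun x => c • v + x) '' C ∪ (fun x => -c • v + x) '' C
  have hBm : MeasurableSet B := by
    refine (IsClosed.measurableSet ?_).union (IsClosed.measurableSet ?_)
    · exact (Homeomorph.addLeft (c • v)).isClosedMap _ hCcl
    · exact (Homeomorph.addLeft (-c • v)).isClosedMap _ hCcl
  have hμB : μ B ≤ 2 * μ C := by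
    refine (measure_union_le _ _).trans_eq ?_
    rw [two_mul]
    exact congrArg₂ _ ((IsometryEquiv.addLeft (c • v)).isometry.euclideanHausdorffMeasure_image C)
      ((IsometryEquiv.addLeft (-c • v)).isometry.euclideanHausdorffMeasure_image C)
  have hlint : ∫⁻ x, ‖p (outerUnitNormal K x)‖ₑ ∂boundaryMeasure K ≤
      ENNReal.ofReal (inner ℝ u v) * (2 * μ C) := by
    calc _ ≤ ∫⁻ x, B.indicator (fun _ => ENNReal.ofReal (inner ℝ u v)) x ∂boundaryMeasure K := by
          refine lintegral_mono_ae ?_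
          filter_upwards [ae_existsUnique_isOuterUnitNormal hconv hr hball hR] with x hx
          rcases normal_trichotomy_of_closure_eq hc hu huv hCu hK hx.1 hx.2 with
            h | ⟨h, y, hy, hxy⟩ | ⟨h, y, hy, hxy⟩
          · rw [hp, h]; simp
          · rw [Set.indicator_of_mem (show x ∈ B from Or.inl ⟨y, hy, by rw [hxy, add_comm]⟩), hp, h,
              abs_of_pos huv, Real.enorm_of_nonneg huv.le]
          · rw [Set.indicator_of_mem (show x ∈ B from Or.inr ⟨y, hy, by rw [hxy, add_comm]⟩), hp, h,
              inner_neg_left, abs_neg, abs_of_pos huv, Real.enorm_of_nonneg huv.le]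
      _ = ENNReal.ofReal (inner ℝ u v) * boundaryMeasure K B := lintegral_indicator_const hBm _
      _ ≤ _ := mul_le_mul' le_rfl ((Measure.restrict_apply_le _ _).trans hμB)
  have hint := integrable_comp_outerUnitNormal hconv hr hball hR p.continuous_euclideanSpace
  have h2 : ENNReal.ofReal c * ∫⁻ x, ‖p (outerUnitNormal K x)‖ₑ ∂boundaryMeasure K ≤ volume K := by
    refine (mul_le_mul' le_rfl hlint).trans (le_trans (le_of_eq ?_) hbase)
    rw [ENNReal.ofReal_mul (by positivity), ENNReal.ofReal_mul (by positivity), ENNReal.ofReal_ofNat]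
    ring
  have h3 := ENNReal.toReal_mono hKfin h2
  rw [ENNReal.toReal_mul, ENNReal.toReal_ofReal hc.le,
    ← integral_norm_eq_lintegral_enorm hint.1] at h3
  simp only [Real.norm_eq_abs, abs_of_nonneg (apply_nonneg p _)] at h3
  exact h3

theorem exists_unit_orthogonal_base (hr : 0 < r) (hball : Metric.closedBall 0 r ⊆ K) (hc : 0 < c)
    (hCconv : Convex ℝ C) (hCsymm : ∀ x ∈ C, -x ∈ C)
    (hCdim : Module.finrank ℝ (vectorSpan ℝ C) + 1 = n)
    (hK : closure K = C + segment ℝ (-(c • v)) (c • v)) :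
    ∃ u, ‖u‖ = 1 ∧ 0 < (inner ℝ u v : ℝ) ∧ ∀ y ∈ C, inner ℝ y u = (0 : ℝ) := by
  have hC0 : (0 : EuclideanSpace ℝ (Fin n)) ∈ C := by
    have h0 : (0 : EuclideanSpace ℝ (Fin n)) ∈ closure K :=
      subset_closure (hball (by simpa using hr.le))
    rw [hK, mem_add_segment_neg_iff hc] at h0
    obtain ⟨y, hy, -⟩ := h0
    have := hCconv hy (hCsymm y hy) (show (0 : ℝ) ≤ 1 / 2 by norm_num)
      (show (0 : ℝ) ≤ 1 / 2 by norm_num) (by norm_num)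
    simpa using this
  have hrank := (vectorSpan ℝ C).finrank_add_finrank_orthogonal
  rw [finrank_euclideanSpace_fin] at hrank
  have hne : (vectorSpan ℝ C)ᗮ ≠ ⊥ := by
    intro h
    rw [h, finrank_bot] at hrank
    omega
  obtain ⟨w, hw, hw0⟩ := (Submodule.ne_bot_iff _).1 hne
  have hCw (y) (hy : y ∈ C) : inner ℝ y w = (0 : ℝ) :=
    (Submodule.mem_orthogonal _ _).1 hw y (by simpa using vsub_mem_vectorSpan ℝ hy hC0)
  -- Otherwise `closure K` would lie in the hyperplane orthogonal to `w`, although it contains a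
  -- ball.
  have hwv : (inner ℝ w v : ℝ) ≠ 0 := by
    intro h
    have hmem : (r * ‖w‖⁻¹) • w ∈ closure K := subset_closure (hball (by
      rw [mem_closedBall_zero_iff, norm_smul, norm_mul, norm_inv, norm_norm, Real.norm_eq_abs,
        abs_of_pos hr, mul_assoc, inv_mul_cancel₀ (norm_ne_zero_iff.2 hw0), mul_one]))
    rw [hK, mem_add_segment_neg_iff hc] at hmem
    obtain ⟨y, hy, s, -, hs⟩ := hmem
    have h1 := congrArg (fun x => (inner ℝ x w : ℝ)) hs
    simp only [inner_add_left, inner_smul_left, hCw y hy, real_inner_comm w v, h, mul_zero,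
      add_zero, RCLike.conj_to_real] at h1
    have hw' := norm_pos_iff.2 hw0
    have : 0 < r * ‖w‖⁻¹ * inner ℝ w w := by
      have := real_inner_self_pos.2 hw0
      positivity
    linarith
  have hw' := norm_pos_iff.2 hw0
  rcases lt_or_gt_of_ne hwv with h | h
  · refine ⟨-‖w‖⁻¹ • w, ?_, ?_, fun y hy => ?_⟩
    · rw [norm_smul, norm_neg, norm_inv, norm_norm, inv_mul_cancel₀ hw'.ne']
    · rw [inner_smul_left]
      exact mul_pos_of_neg_of_neg (neg_neg_of_pos (inv_pos.2 hw')) h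
    · rw [inner_smul_right, hCw y hy, mul_zero]
  · refine ⟨‖w‖⁻¹ • w, ?_, ?_, fun y hy => ?_⟩
    · rw [norm_smul, norm_inv, norm_norm, inv_mul_cancel₀ hw'.ne']
    · rw [inner_smul_left]
      exact mul_pos (inv_pos.2 hw') h
    · rw [inner_smul_right, hCw y hy, mul_zero]

theorem integral_eq_of_cylinder (hconv : Convex ℝ K) (hr : 0 < r)
    (hball : Metric.closedBall 0 r ⊆ K) (hR : ∀ x ∈ K, ‖x‖ ≤ R) (hsymm : ∀ x ∈ K, -x ∈ K)
    {p : Seminorm ℝ (EuclideanSpace ℝ (Fin n))} (hp0 : p ≠ 0)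
    (hp : ∀ x, p x = |(inner ℝ x v : ℝ)|) (hc : 0 < c)
    (hCconv : Convex ℝ C) (hCsymm : ∀ x ∈ C, -x ∈ C)
    (hCdim : Module.finrank ℝ (vectorSpan ℝ C) + 1 = n)
    (hK : closure K = C + segment ℝ (-(c • v)) (c • v)) :
    ∫ x, p (outerUnitNormal K x) ^ 2 / inner ℝ x (outerUnitNormal K x) ∂(boundaryMeasure K) =
      1 / volume.real K * (∫ x, p (outerUnitNormal K x) ∂(boundaryMeasure K)) ^ 2 := by
  obtain ⟨u, hu, huv, hCu⟩ := exists_unit_orthogonal_base hr hball hc hCconv hCsymm hCdim hK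
  refine le_antisymm (integral_sq_div_le hconv hr hball hR hsymm p) ?_
  -- On the bases `⟨x, n⟩ = c * p n`, and elsewhere `p n = 0`, up to a null set.
  have hlhs : ∫ x, p (outerUnitNormal K x) ^ 2 / inner ℝ x (outerUnitNormal K x)
      ∂(boundaryMeasure K) = c⁻¹ * ∫ x, p (outerUnitNormal K x) ∂(boundaryMeasure K) := by
    rw [← integral_const_mul]
    refine integral_congr_ae ?_
    filter_upwards [ae_existsUnique_isOuterUnitNormal hconv hr hball hR] with x hx
    have hvu : (inner ℝ v u : ℝ) = inner ℝ u v := real_inner_comm _ _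
    rcases normal_trichotomy_of_closure_eq hc hu huv hCu hK hx.1 hx.2 with
      h | ⟨h, y, hy, hxy⟩ | ⟨h, y, hy, hxy⟩
    · rw [hp, h]; simp
    · rw [hp, h, abs_of_pos huv, hxy, inner_add_left, hCu y hy, inner_smul_left, hvu]
      simp only [RCLike.conj_to_real]
      field_simp; ring
    · rw [hp, h, inner_neg_left, abs_neg, abs_of_pos huv, hxy, inner_neg_right, inner_add_left,
        hCu y hy, inner_smul_left, hvu]
      simp only [RCLike.conj_to_real]
      field_simp; ring
  rw [hlhs]
  have hle := integral_seminorm_le_of_cylinder hconv hr hball hR hp hc hu huv hCu hK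
  have hI := integral_seminorm_pos hconv hr hball hR hp0
  have hKpos := measureReal_pos_of_ball hr hball hR
  rw [one_div, inv_mul_le_iff₀ hKpos, ← mul_assoc, ← div_eq_mul_inv, sq]
  gcongr
  rwa [le_div_iff₀ hc, mul_comm]

theorem exists_cylinder_of_integral_eq (hconv : Convex ℝ K) (hr : 0 < r)
    (hball : Metric.closedBall 0 r ⊆ K) (hR : ∀ x ∈ K, ‖x‖ ≤ R) (hsymm : ∀ x ∈ K, -x ∈ K)
    {p : Seminorm ℝ (EuclideanSpace ℝ (Fin n))} (hp0 : p ≠ 0)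
    (heq : ∫ x, p (outerUnitNormal K x) ^ 2 / inner ℝ x (outerUnitNormal K x)
        ∂(boundaryMeasure K) =
      1 / volume.real K * (∫ x, p (outerUnitNormal K x) ∂(boundaryMeasure K)) ^ 2) :
    ∃ (v : EuclideanSpace ℝ (Fin n)) (c : ℝ) (C : Set (EuclideanSpace ℝ (Fin n))),
      0 < c ∧ (∀ x, p x = |inner ℝ x v|) ∧
      Convex ℝ C ∧ (∀ x ∈ C, -x ∈ C) ∧ Module.finrank ℝ (vectorSpan ℝ C) + 1 = n ∧
      closure K = C + segment ℝ (-(c • v)) (c • v) := by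
  have hint : (interior K).Nonempty := ⟨0, mem_interior_iff_mem_nhds.2
    (Filter.mem_of_superset (Metric.closedBall_mem_nhds _ hr) hball)⟩
  have hi := integrable_comp_outerUnitNormal hconv hr hball hR p.continuous_euclideanSpace
  have hi2 := integrable_sq_div hconv hr hball hR hsymm p
  have hKpos := measureReal_pos_of_ball hr hball hR
  have hI := integral_seminorm_pos hconv hr hball hR hp0
  set I := ∫ x, p (outerUnitNormal K x) ∂(boundaryMeasure K) with hIdef
  have hregae := ae_existsUnique_isOuterUnitNormal hconv hr hball hR
  have haeq : ∀ᵐ x ∂boundaryMeasure K, I / volume.real K * p (outerUnitNormal K x) -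
      p (outerUnitNormal K x) ^ 2 / inner ℝ x (outerUnitNormal K x) = 0 := by
    refine (integral_eq_zero_iff_of_nonneg_ae ?_ ((hi.const_mul _).sub hi2)).1 ?_
    · filter_upwards [ae_sq_div_le hconv hr hball hR hsymm p] with x hx
      exact sub_nonneg.2 hx.2
    · rw [integral_sub' (hi.const_mul _) hi2, integral_const_mul, heq, ← hIdef]; ring
  -- Since the integral of `p n` is positive, some regular point has `p n ≠ 0` and equality in the
  -- pointwise bound.
  obtain ⟨x, hpx, hx, hreg, hxeq⟩ : ∃ x, p (outerUnitNormal K x) ≠ 0 ∧ x ∈ frontier K ∧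
      (∃! u, IsOuterUnitNormal K x u) ∧ I / volume.real K * p (outerUnitNormal K x) -
        p (outerUnitNormal K x) ^ 2 / inner ℝ x (outerUnitNormal K x) = 0 := by
    by_contra! hcon
    refine hI.ne' (integral_eq_zero_of_ae ?_)
    filter_upwards [haeq, hregae] with x h1 h2
    by_contra h
    exact hcon x h h2.1 h2.2 h1
  have hn := isOuterUnitNormal_outerUnitNormal hreg
  set u := outerUnitNormal K x
  have hpu : 0 < p u := lt_of_le_of_ne (apply_nonneg p u) hpx.symm
  have hh := hn.abs_inner_lt hsymm
  have hh0 := hr.trans_le (hn.le_inner hr hball)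
  set h : ℝ := inner ℝ x u
  have hkey : p u * volume.real K = h * I := by
    rw [sub_eq_zero, div_mul_eq_mul_div, div_eq_div_iff hKpos.ne' hh0.ne'] at hxeq
    have := mul_left_cancel₀ hpx (show p u * (p u * volume.real K) = p u * (h * I) by linarith)
    exact this
  obtain ⟨v, hv, hvp⟩ := p.exists_inner_eq u
  have huv : 0 < (inner ℝ u v : ℝ) := by rwa [hv]
  obtain ⟨htop, hcyl⟩ := inner_mul_measureReal_slabCylinder_le hconv hr hball hR huv hh0
  have hcylK := (inner_mul_measureReal_le hconv hr hball hR huv hh).1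
  have hiv : Integrable (fun x => |(inner ℝ (outerUnitNormal K x) v : ℝ)|) (boundaryMeasure K) :=
    integrable_comp_outerUnitNormal hconv hr hball hR (f := fun y => |inner ℝ y v|) (by fun_prop)
  have hIv : ∫ x, |(inner ℝ (outerUnitNormal K x) v : ℝ)| ∂boundaryMeasure K ≤ I :=
    integral_mono hiv hi fun x => hvp _
  have hIv' := mul_le_mul_of_nonneg_left hIv hh0.le
  rw [← hv] at hkey
  -- The chain `⟨u, v⟩ |K| ≤ ⟨u, v⟩ |Z| ≤ h ∫ |⟨n, v⟩| ≤ h ∫ p n`, with `Z` the slab cylinder, has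
  -- equal ends by `hkey`, so all its terms agree. The first equality gives the shape of `K`; the
  -- last gives `p = |⟨·, v⟩|` at almost every normal.
  have hsub := slabCylinder_subset_closure hconv hh htop
    (le_of_mul_le_mul_left (show inner ℝ u v * volume.real (slabCylinder K u v h) ≤
      inner ℝ u v * volume.real K by linarith) huv)
  have hK := closure_eq_obliqueProj_add_segment hconv hint huv hh hsub
  have hc : 0 < h / (inner ℝ u v : ℝ) := by positivity
  have hCu : ∀ y ∈ obliqueProj u v '' closure K, inner ℝ y u = (0 : ℝ) := by
    rintro _ ⟨y, -, rfl⟩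
    exact inner_obliqueProj huv.ne' y
  refine ⟨v, h / inner ℝ u v, obliqueProj u v '' closure K, hc,
    seminorm_eq_abs_inner hconv hr hball hR huv hv.symm ?_ ?_,
    hconv.closure.linear_image _, ?_, ?_, hK⟩
  · have hzero : ∫ x, (p (outerUnitNormal K x) - |(inner ℝ (outerUnitNormal K x) v : ℝ)|)
        ∂boundaryMeasure K = 0 := by
      rw [integral_sub hi hiv, sub_eq_zero]
      exact le_antisymm (le_of_mul_le_mul_left (by linarith) hh0) hIv
    have := (integral_eq_zero_iff_of_nonneg (fun x => sub_nonneg.2 (hvp _)) (hi.sub hiv)).1 hzero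
    filter_upwards [this] with x hx
    exact sub_eq_zero.1 hx
  · filter_upwards [hregae] with x hx
    rcases normal_trichotomy_of_closure_eq hc hn.1 huv hCu hK hx.1 hx.2 with h | h | h
    · exact Or.inl h
    · exact Or.inr (Or.inl h.1)
    · exact Or.inr (Or.inr h.1)
  · rintro _ ⟨y, hy, rfl⟩
    refine ⟨-y, ?_, map_neg _ _⟩
    exact (show Set.MapsTo (fun y => -y) K K from hsymm).closure continuous_neg hy
  · have hspan : vectorSpan ℝ (closure K) = ⊤ := by
      rw [← direction_affineSpan, affineSpan_eq_top_of_nonempty_interior, AffineSubspace.direction_top]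
      exact hint.mono ((interior_mono subset_closure).trans
        (interior_mono (subset_convexHull ℝ _)))
    have := (obliqueProj u v).toAffineMap.map_vectorSpan (s := closure K)
    rw [hspan, LinearMap.toAffineMap_linear, Submodule.map_top] at this
    rw [show obliqueProj u v '' closure K = (obliqueProj u v).toAffineMap '' closure K from rfl,
      ← this]
    exact finrank_range_obliqueProj huv.ne'

end Equality

theorem mainTheorem1 (n : ℕ) (K : Set (EuclideanSpace ℝ (Fin n)))
    (hconv : Convex ℝ K) (hbdd : Bornology.IsBounded K) (hint : (interior K).Nonempty)
    (hsymm : ∀ x ∈ K, -x ∈ K) (p : Seminorm ℝ (EuclideanSpace ℝ (Fin n))) :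
    Integrable (fun x => p (outerUnitNormal K x) ^ 2 / inner ℝ x (outerUnitNormal K x))
        (boundaryMeasure K) ∧
    Integrable (fun x => p (outerUnitNormal K x)) (boundaryMeasure K) ∧
    ∫ x, p (outerUnitNormal K x) ^ 2 / inner ℝ x (outerUnitNormal K x) ∂(boundaryMeasure K) ≤
        1 / volume.real K * (∫ x, p (outerUnitNormal K x) ∂(boundaryMeasure K)) ^ 2 ∧
    (p ≠ 0 →
      (∫ x, p (outerUnitNormal K x) ^ 2 / inner ℝ x (outerUnitNormal K x) ∂(boundaryMeasure K) =
          1 / volume.real K * (∫ x, p (outerUnitNormal K x) ∂(boundaryMeasure K)) ^ 2 ↔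
        ∃ (v : EuclideanSpace ℝ (Fin n)) (c : ℝ) (C : Set (EuclideanSpace ℝ (Fin n))),
          0 < c ∧ (∀ x, p x = |inner ℝ x v|) ∧
          Convex ℝ C ∧ (∀ x ∈ C, -x ∈ C) ∧ Module.finrank ℝ (vectorSpan ℝ C) + 1 = n ∧
          closure K = C + segment ℝ (-(c • v)) (c • v))) := by
  obtain ⟨r, hr, hball⟩ := exists_closedBall_subset_of_symm hconv hint hsymm
  obtain ⟨R, hR⟩ := hbdd.exists_norm_le
  refine ⟨integrable_sq_div hconv hr hball hR hsymm p,
    integrable_comp_outerUnitNormal hconv hr hball hR p.continuous_euclideanSpace,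
    integral_sq_div_le hconv hr hball hR hsymm p, fun hp0 => ⟨fun heq =>
      exists_cylinder_of_integral_eq hconv hr hball hR hsymm hp0 heq, ?_⟩⟩
  rintro ⟨v, c, C, hc, hp, hCconv, hCsymm, hCdim, hK⟩
  exact integral_eq_of_cylinder hconv hr hball hR hsymm hp0 hp hc hCconv hCsymm hCdim hK
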